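/- **Setting.** Let $\Sigma$ be a finite token space, let $\mathcal X$ be a set of token strings over $\Sigma$ (prompts), let $T\ge 1$, and let $\rho$ be a (discrete) probability distribution on $\mathcal X$. A deterministic model $\pi$ maps every token string to a token. On a prompt $x$ it generates the chain of thought $\pi_{1:T}(x)=(y_1,\dots,y_T)$ with $y_t=\pi(x,y_1,\dots,y_{t-1})$, and its answer is $\pi_T(x)=y_T$. Let $\mathcal V:\mathcal X\times\Sigma\to\{0,1\}$ be an outcome verifier; the accuracy of $f:\mathcal X\to\Sigma$ is $\mathrm{Acc}_\rho(f)=\Pr_{x\sim\rho}(\mathcal V(x,f(x))=1)$. Let $\Pi$ be a class of deterministic models of finite Natarajan dimension $d$ that contains a model $\pi^\star$ with $\mathrm{Acc}_\rho(\pi^\star_T)=1$. A reference model $\pi_{\mathrm{ref}}(\cdot\mid x)$ is a conditional distribution on $\Sigma^T$. For $C_{\mathrm{seq}}\ge 1$ it satisfies *$(C_{\mathrm{seq}},\eta)$ partial sequence-level coverage* if $$\Pr_{x\sim\rho}\big(\pi_{\mathrm{ref}}(\pi^\star_{1:T}(x)\mid x)\ge C_{\mathrm{seq}}^{-1}\big)\ge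 1-\eta .$$ **Algorithm RLFineTune.** Given i.i.d. prompts $x_1,\dots,x_n\sim\rho$: for each $i$, draw $m=\lceil C_{\mathrm{seq}}\log(4nC_{\mathrm{seq}}/\delta)\rceil$ independent responses from $\pi_{\mathrm{ref}}(\cdot\mid x_i)$ (each returned together with its probability), call the verifier on each of them, and let $\widetilde D_i$ be the set of the drawn $y$ with $\mathcal V(x_i,y_T)=1$ and $\pi_{\mathrm{ref}}(y\mid x_i)\ge C_{\mathrm{seq}}^{-1}$. Choose (with arbitrary tie-breaking) $$\widehat\pi\in\arg\min_{\pi\in\Pi}\frac1n\sum_{i=1}^n\mathbf 1\big(\pi_{1:T}(x_i)\notin\widetilde D_i\big)$$ and return the outcome-level model $\widehat f=\widehat\pi_T$. **Theorem (learning with partial sequence-level coverage).** There are absolute constants $C_1,C_2,C_3>0$ such that the following holds in every such setting and for all $\varepsilon,\delta\in(0,1)$. Suppose that $\pi_{\mathrm{ref}}$ satisfies $(C_{\mathrm{seq}},\eta)$ partial sequence-level coverage, that $n\ge 2$, and that $$n\ \ge\ C_1\,\frac{d\,\log(T\,|\Sigma|\,C_{\mathrm{seq}})\,\log n+\log(1/\delta)}{\varepsilon}.$$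 Then, with probability at least $1-\delta$ over the prompts and the rollouts, $\mathrm{Acc}_\rho(\widehat f)\ge 1-C_2(\varepsilon+\eta)$. Furthermore, RLFineTune always generates at most $C_3\,n\,C_{\mathrm{seq}}\log(nC_{\mathrm{seq}}/\delta)$ responses from $\pi_{\mathrm{ref}}$ and calls the verifier at most that many times. -/

import Mathlib

/-! ### Strings, deterministic next-token models, chains of thought -/

/-- Token strings of finite or infinite length. -/
abbrev TokenString (Tok : Type*) := Stream'.Seq Tok

/-- A deterministic next-token predictor: it maps every token prefix to a single token. -/
abbrev NextTokenModel (Tok : Type*) := TokenString Tok → Tok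

/-- Responses: token sequences of length `T`. -/
abbrev Response (Tok : Type*) (T : ℕ) := Fin T → Tok

namespace NextTokenModel

variable {Tok : Type*}

/-- The first `t` tokens `y₁, …, y_t` that are decoded autoregressively on the prompt `x`:
`y_{t+1} = π (x, y₁, …, y_t)`. -/
def decode (π : NextTokenModel Tok) (x : TokenString Tok) : ℕ → List Tok
  | 0 => []
  | t + 1 => decode π x t ++ [π (x.append (Stream'.Seq.ofList (decode π x t)))]

/-- The chain of thought `π_{1:T}(x)`. -/
def cot (π : NextTokenModel Tok) (T : ℕ) (x : TokenString Tok) : Response Tok T :=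
  fun t => π (x.append (Stream'.Seq.ofList (π.decode x t)))

end NextTokenModel

/-- The answer `y_T`, that is, the last token of a response. -/
def Response.answer {Tok : Type*} {T : ℕ} [NeZero T] (y : Response Tok T) : Tok :=
  y ⟨T - 1, Nat.sub_lt (NeZero.pos T) Nat.one_pos⟩

/-- The outcome-level model `π_T`, which answers a prompt by the last token of `π_{1:T}`. -/
def NextTokenModel.outcome {Tok : Type*} (π : NextTokenModel Tok) (T : ℕ) [NeZero T]
    (x : TokenString Tok) : Tok :=
  Response.answer (π.cot T x)

/-! ### Natarajan dimension -/

/-- `S` is shattered, in the sense of Natarajan, by the class `F`. -/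
def NatarajanShatters {α β : Type*} (F : Set (α → β)) (S : Finset α) : Prop :=
  ∃ f₀ f₁ : α → β, (∀ a ∈ S, f₀ a ≠ f₁ a) ∧
    ∀ B ⊆ S, ∃ h ∈ F, (∀ a ∈ B, h a = f₀ a) ∧ ∀ a ∈ S, a ∉ B → h a = f₁ a

/-- The Natarajan dimension: the largest size of a shattered finite set (possibly infinite). -/
noncomputable def natarajanDim {α β : Type*} (F : Set (α → β)) : ℕ∞ :=
  ⨆ (S : Finset α) (_ : NatarajanShatters F S), (S.card : ℕ∞)

/-! ### Probability, accuracy, coverage -/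

/-- The probability of an event under a discrete distribution. -/
noncomputable def PMF.pr {α : Type*} (p : PMF α) (s : Set α) : ℝ :=
  (p.toOuterMeasure s).toReal

/-- The law of `n` i.i.d. draws from `p`. -/
noncomputable def PMF.iid {α : Type*} (p : PMF α) : (n : ℕ) → PMF (Fin n → α)
  | 0 => PMF.pure Fin.elim0
  | n + 1 => p.bind fun a => (PMF.iid p n).map fun v => Fin.cons (α := fun _ => α) a v

section Setting

variable {Tok : Type*} {X : Set (TokenString Tok)}

/-- Accuracy of a (deterministic) outcome-level model `f` with respect to the verifier `V`:
the probability over a prompt drawn from `ρ` that the answer of `f` is accepted. -/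
noncomputable def accuracy (ρ : PMF X) (V : X → Tok → Bool) (f : X → Tok) : ℝ :=
  ρ.pr {x | V x (f x) = true}

/-- The reference model `πref` satisfies `(C, η)` partial sequence-level coverage of the chains of
thought of `πstar` under the prompt distribution `ρ`. -/
def PartialSeqCoverage {T : ℕ} (ρ : PMF X) (πref : X → PMF (Response Tok T))
    (πstar : NextTokenModel Tok) (C η : ℝ) : Prop :=
  1 - η ≤ ρ.pr {x | C⁻¹ ≤ (πref x (πstar.cot T x)).toReal}

end Setting

/-! ### Programs with query access to a reference model and to an outcome verifier -/

/-- Programs that return a value of type `α` and may, on the way,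
* request a response drawn from the reference model on a prompt; the oracle returns the response
  together with its probability under the reference model;
* query the outcome verifier at a prompt and an answer. -/
inductive OracleProg (X Y A : Type*) (α : Type*)
  | pure (a : α) : OracleProg X Y A α
  | rollout (x : X) (k : Y → ℝ → OracleProg X Y A α) : OracleProg X Y A α
  | verify (x : X) (a : A) (k : Bool → OracleProg X Y A α) : OracleProg X Y A α

/-- The result of an execution, with the number of oracle calls made. -/
structure Execution (α : Type*) where
  result : α
  rollouts : ℕ
  verifierCalls : ℕ

namespace OracleProg

variable {X Y A α β : Type*}

/-- Sequential composition of programs. -/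
def bind (p : OracleProg X Y A α) (f : α → OracleProg X Y A β) : OracleProg X Y A β :=
  match p with
  | .pure a => f a
  | .rollout x k => .rollout x fun y q => (k y q).bind f
  | .verify x a k => .verify x a fun b => (k b).bind f

/-- The distribution of the execution of a program: every rollout is a fresh draw from the
reference model, and every call to an oracle is counted. -/
noncomputable def run (πref : X → PMF Y) (V : X → A → Bool) :
    OracleProg X Y A α → PMF (Execution α)
  | .pure a => PMF.pure ⟨a, 0, 0⟩
  | .rollout x k => (πref x).bind fun y =>
      (run πref V (k y (πref x y).toReal)).map fun e =>
        { e with rollouts := e.rollouts + 1 }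
  | .verify x a k => (run πref V (k (V x a))).map fun e =>
        { e with verifierCalls := e.verifierCalls + 1 }

end OracleProg

/-! ### The algorithm `RLFineTune` -/

section RLFineTune

variable {Tok : Type*} {X : Set (TokenString Tok)} {T : ℕ} [NeZero T]

open Classical in
/-- Rejection sampling on the prompt `x`: draw `m` responses from the reference model, call the
verifier on each of them, and return the set of the distinct responses with a correct answer and
with probability at least `C⁻¹` under the reference model. -/
noncomputable def rejectionSample (C : ℝ) (x : X) :
    ℕ → OracleProg X (Response Tok T) Tok (Finset (Response Tok T))
  | 0 => .pure ∅
  | m + 1 => .rollout x fun y q => .verify x y.answer fun b =>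
      (rejectionSample C x m).bind fun D =>
        .pure (if C⁻¹ ≤ q ∧ b = true then insert y D else D)

/-- Rejection sampling on each of the prompts `x₁, …, x_n`. -/
noncomputable def rejectionSampleAll (C : ℝ) (m : ℕ) : {n : ℕ} → (Fin n → X) →
    OracleProg X (Response Tok T) Tok (Fin n → Finset (Response Tok T))
  | 0, _ => .pure Fin.elim0
  | _ + 1, xs => (rejectionSample C (xs 0) m).bind fun D =>
      (rejectionSampleAll C m fun i => xs i.succ).bind fun Ds =>
        .pure (Fin.cons (α := fun _ => Finset (Response Tok T)) D Ds)

open Classical in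
/-- The empirical indicator loss `(1/n) ∑ᵢ 𝟙 (π_{1:T}(xᵢ) ∉ Dᵢ)`. -/
noncomputable def indicatorLoss {n : ℕ} (π : NextTokenModel Tok) (xs : Fin n → X)
    (Ds : Fin n → Finset (Response Tok T)) : ℝ :=
  (∑ i, if π.cot T (xs i) ∈ Ds i then (0 : ℝ) else 1) / n

/-- `erm` is an empirical risk minimizer over the class `M` for the indicator loss, with an
arbitrary rule to break ties. -/
def IsERM {n : ℕ} (M : Set (NextTokenModel Tok))
    (erm : (Fin n → X) → (Fin n → Finset (Response Tok T)) → NextTokenModel Tok) : Prop :=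
  ∀ xs Ds, erm xs Ds ∈ M ∧ ∀ π ∈ M, indicatorLoss (erm xs Ds) xs Ds ≤ indicatorLoss π xs Ds

/-- The number of rollouts per prompt, `⌈C log (4 n C / δ)⌉`. -/
noncomputable def rolloutsPerPrompt (n : ℕ) (C δ : ℝ) : ℕ :=
  ⌈C * Real.log (4 * n * C / δ)⌉₊

/-- `RLFineTune`: rejection sampling on all prompts of the dataset, followed by empirical risk
minimization; the outcome-level model of the minimizer is returned. -/
noncomputable def rlFineTune {n : ℕ}
    (erm : (Fin n → X) → (Fin n → Finset (Response Tok T)) → NextTokenModel Tok)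
    (C δ : ℝ) (xs : Fin n → X) : OracleProg X (Response Tok T) Tok (X → Tok) :=
  (rejectionSampleAll C (rolloutsPerPrompt n C δ) xs).bind fun Ds =>
    .pure fun x => (erm xs Ds).outcome T x

/-- The law of the execution of `RLFineTune` on `n` i.i.d. prompts drawn from `ρ`. -/
noncomputable def rlFineTuneLaw {n : ℕ} (ρ : PMF X) (πref : X → PMF (Response Tok T))
    (V : X → Tok → Bool)
    (erm : (Fin n → X) → (Fin n → Finset (Response Tok T)) → NextTokenModel Tok)
    (C δ : ℝ) : PMF (Execution (X → Tok)) :=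
  (ρ.iid n).bind fun xs => (rlFineTune erm C δ xs).run πref V

end RLFineTune

/-! Call a response accepted at `x` if its answer is verified and its reference probability is at
least `C⁻¹`; `acceptedSet` is the set of these. At most `C` responses are accepted at each prompt,
and one rollout hits a given one with probability at least `C⁻¹`. A union bound over prompts and
accepted responses shows that, outside an event of probability `δ / 4`, rejection sampling recovers
every accepted set exactly (`expect_rejectionSampleAll_rolloutsPerPrompt_ne`). The algorithm is then
empirical risk minimization for a loss that depends only on the prompt: the chain of thought leaves
the accepted set. This loss has mean at most `η` for `πstar`, and it dominates the answer error of
every model.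

The loss class has few traces. Whether `π` generates `y` depends only on the values of `π` on the
`T` proper prefixes of `y` (`NextTokenModel.cot_eq_iff`), so on `2n` prompts all losses are
determined by at most `2nCT` strings, and Natarajan's lemma bounds the number of patterns
(`exists_cover_cot`).

A multiplicative deviation bound (`PMF.pr_exists_hits_le`) then avoids the slow agnostic rate. With
`α = ε + η`, a Chernoff bound gives `πstar` at most `2nα` empirical errors, while a model of risk at
least `20α` is unlikely to have so few. The deviation bound comes from a ghost sample and random
exchanges, applied to the expected supremum of the weights `(1/2)^k (3/2)^l`. -/

open scoped ENNReal

/-! ### Expectations and i.i.d. samples of discrete distributions -/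

namespace PMF

variable {α β : Type*}

/-- The expectation of a nonnegative function under a discrete distribution. -/
noncomputable def expect (p : PMF α) (f : α → ℝ≥0∞) : ℝ≥0∞ := ∑' a, p a * f a

theorem toOuterMeasure_eq_expect (p : PMF α) (s : Set α) :
    p.toOuterMeasure s = p.expect (s.indicator 1) := by
  rw [toOuterMeasure_apply, expect]
  refine tsum_congr fun a => ?_
  by_cases h : a ∈ s <;> simp [h]

theorem expect_mono (p : PMF α) {f g : α → ℝ≥0∞} (h : ∀ a, f a ≤ g a) :
    p.expect f ≤ p.expect g :=
  ENNReal.tsum_le_tsum fun a => mul_le_mul_right (h a) _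

theorem expect_mono_support (p : PMF α) {f g : α → ℝ≥0∞} (h : ∀ a ∈ p.support, f a ≤ g a) :
    p.expect f ≤ p.expect g := by
  refine ENNReal.tsum_le_tsum fun a => ?_
  by_cases ha : p a = 0
  · simp [ha]
  · exact mul_le_mul_right (h a ((p.mem_support_iff a).2 ha)) _

@[simp] theorem expect_const (p : PMF α) (c : ℝ≥0∞) : p.expect (fun _ => c) = c := by
  simp [expect, ENNReal.tsum_mul_right, p.tsum_coe]

theorem expect_add (p : PMF α) (f g : α → ℝ≥0∞) :
    p.expect (fun a => f a + g a) = p.expect f + p.expect g := by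
  simp [expect, mul_add, ENNReal.tsum_add]

theorem expect_const_mul (p : PMF α) (c : ℝ≥0∞) (f : α → ℝ≥0∞) :
    p.expect (fun a => c * f a) = c * p.expect f := by
  simp only [expect, ← ENNReal.tsum_mul_left]
  exact tsum_congr fun a => mul_left_comm _ _ _

theorem expect_mul_const (p : PMF α) (c : ℝ≥0∞) (f : α → ℝ≥0∞) :
    p.expect (fun a => f a * c) = p.expect f * c := by
  simp only [mul_comm _ c, expect_const_mul]

theorem expect_finset_sum {ι : Type*} (p : PMF α) (s : Finset ι) (f : ι → α → ℝ≥0∞) :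
    p.expect (fun a => ∑ i ∈ s, f i a) = ∑ i ∈ s, p.expect (f i) := by
  classical
  induction s using Finset.induction_on with
  | empty => simp
  | insert i s hi ih => simp only [Finset.sum_insert hi, expect_add, ih]

@[simp] theorem expect_pure (a : α) (f : α → ℝ≥0∞) : (PMF.pure a).expect f = f a := by
  rw [expect, tsum_eq_single a]
  · simp
  · intro b hb
    simp [hb]

theorem expect_bind (p : PMF α) (q : α → PMF β) (f : β → ℝ≥0∞) :
    (p.bind q).expect f = p.expect fun a => (q a).expect f := by
  simp only [expect, bind_apply, ← ENNReal.tsum_mul_right, ← ENNReal.tsum_mul_left]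
  rw [ENNReal.tsum_comm]
  exact tsum_congr fun a => tsum_congr fun b => mul_assoc _ _ _

theorem expect_map (p : PMF α) (g : α → β) (f : β → ℝ≥0∞) :
    (p.map g).expect f = p.expect (f ∘ g) := by
  simp [PMF.map, expect_bind, Function.comp_def]

theorem iid_apply (p : PMF α) : ∀ (n : ℕ) (v : Fin n → α), p.iid n v = ∏ i, p (v i)
  | 0, v => by simp [iid, Subsingleton.elim v Fin.elim0]
  | n + 1, v => by
    classical
    have h : ∀ a w, (v = Fin.cons (α := fun _ => α) a w) ↔ (a = v 0 ∧ w = Fin.tail v) := by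
      intro a w
      constructor
      · rintro rfl
        simp
      · rintro ⟨rfl, rfl⟩
        simp
    simp only [iid, bind_apply, map_apply, h]
    rw [tsum_eq_single (v 0)]
    · rw [tsum_eq_single (Fin.tail v)]
      · simp [iid_apply p n, Fin.prod_univ_succ, Fin.tail]
      · intro w hw
        simp [hw]
    · intro a ha
      simp [ha]

theorem expect_iid_prod (p : PMF α) (f : α → ℝ≥0∞) :
    ∀ n : ℕ, (p.iid n).expect (fun v => ∏ i, f (v i)) = p.expect f ^ n
  | 0 => by simp [iid]
  | n + 1 => by
    simp only [iid, expect_bind, expect_map, Function.comp_def, Fin.prod_univ_succ, Fin.cons_zero,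
      Fin.cons_succ, expect_const_mul, expect_iid_prod p f n, expect_mul_const]
    rw [pow_succ']

/-- Exchanging the coordinates in `σ` between two independent i.i.d. samples does not change
their joint law. -/
theorem expect_iid_swap (p : PMF α) (n : ℕ) (σ : Fin n → Bool)
    (F : (Fin n → α) → (Fin n → α) → ℝ≥0∞) :
    ((p.iid n).expect fun v => (p.iid n).expect fun w => F v w) =
      (p.iid n).expect fun v => (p.iid n).expect fun w =>
        F (fun i => if σ i then w i else v i) (fun i => if σ i then v i else w i) := by
  -- The exchange is an involution of pairs of samples that preserves their product weight, so the
  -- double sum can be reindexed along it.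
  let g : (Fin n → α) × (Fin n → α) → (Fin n → α) × (Fin n → α) :=
    fun z => (fun i => if σ i then z.2 i else z.1 i, fun i => if σ i then z.1 i else z.2 i)
  have hg : Function.Involutive g := by
    rintro ⟨v, w⟩
    refine Prod.ext (funext fun i => ?_) (funext fun i => ?_) <;> by_cases h : σ i <;> simp [g, h]
  have hw : ∀ z, p.iid n (g z).1 * p.iid n (g z).2 = p.iid n z.1 * p.iid n z.2 := by
    intro z
    simp only [iid_apply, ← Finset.prod_mul_distrib]
    refine Finset.prod_congr rfl fun i _ => ?_
    by_cases h : σ i <;> simp [g, h, mul_comm]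
  have key : ∀ H : (Fin n → α) × (Fin n → α) → ℝ≥0∞,
      ((p.iid n).expect fun v => (p.iid n).expect fun w => H (v, w)) =
        ∑' z, p.iid n z.1 * p.iid n z.2 * H z := by
    intro H
    simp only [expect, ← ENNReal.tsum_mul_left, ← mul_assoc]
    exact (ENNReal.tsum_prod (f := fun v w => p.iid n v * p.iid n w * H (v, w))).symm
  rw [key fun z => F z.1 z.2, key fun z => F (g z).1 (g z).2,
    ← (Function.Involutive.toPerm g hg).tsum_eq]
  refine tsum_congr fun z => ?_
  rw [Function.Involutive.coe_toPerm, hw]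

theorem pr_eq_toReal_expect (p : PMF α) (s : Set α) : p.pr s = (p.expect (s.indicator 1)).toReal := by
  rw [pr, toOuterMeasure_eq_expect]

theorem expect_indicator_add_compl (p : PMF α) (s : Set α) :
    p.expect (s.indicator 1) + p.expect (sᶜ.indicator 1) = 1 := by
  rw [← expect_add, ← p.expect_const 1]
  congr 1
  ext a
  by_cases h : a ∈ s <;> simp [h]

theorem expect_indicator_le_one (p : PMF α) (s : Set α) : p.expect (s.indicator 1) ≤ 1 :=
  (p.expect_indicator_add_compl s).symm ▸ le_self_add

theorem expect_indicator_ne_top (p : PMF α) (s : Set α) : p.expect (s.indicator 1) ≠ ∞ :=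
  ne_top_of_le_ne_top ENNReal.one_ne_top (p.expect_indicator_le_one s)

theorem ofReal_pr (p : PMF α) (s : Set α) :
    ENNReal.ofReal (p.pr s) = p.expect (s.indicator 1) := by
  rw [pr_eq_toReal_expect, ENNReal.ofReal_toReal (p.expect_indicator_ne_top s)]

theorem pr_nonneg (p : PMF α) (s : Set α) : 0 ≤ p.pr s := ENNReal.toReal_nonneg

theorem pr_add_compl (p : PMF α) (s : Set α) : p.pr s + p.pr sᶜ = 1 := by
  rw [pr_eq_toReal_expect, pr_eq_toReal_expect,
    ← ENNReal.toReal_add (p.expect_indicator_ne_top _) (p.expect_indicator_ne_top _),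
    expect_indicator_add_compl, ENNReal.toReal_one]

theorem pr_mono (p : PMF α) {s t : Set α} (h : s ⊆ t) : p.pr s ≤ p.pr t := by
  rw [pr_eq_toReal_expect, pr_eq_toReal_expect]
  exact ENNReal.toReal_mono (p.expect_indicator_ne_top _)
    (p.expect_mono fun a => Set.indicator_le_indicator_of_subset h (fun _ => bot_le) a)

theorem pr_union_le (p : PMF α) (s t : Set α) : p.pr (s ∪ t) ≤ p.pr s + p.pr t := by
  simp only [pr_eq_toReal_expect]
  rw [← ENNReal.toReal_add (p.expect_indicator_ne_top _) (p.expect_indicator_ne_top _),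
    ← expect_add]
  refine ENNReal.toReal_mono ?_ (p.expect_mono fun a => ?_)
  · rw [expect_add]
    exact ENNReal.add_ne_top.2 ⟨p.expect_indicator_ne_top _, p.expect_indicator_ne_top _⟩
  · by_cases hs : a ∈ s <;> by_cases ht : a ∈ t <;> simp [hs, ht]

theorem pr_le_of_expect_le (p : PMF α) (s : Set α) {c : ℝ} (hc : 0 ≤ c)
    (h : p.expect (s.indicator 1) ≤ ENNReal.ofReal c) : p.pr s ≤ c := by
  rw [pr_eq_toReal_expect]
  exact ENNReal.toReal_le_of_le_ofReal hc h

end PMF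

/-! ### Hit counts and Chernoff bounds -/

open Classical in
/-- The number of points of the sample `v` that lie in the set `A`. -/
noncomputable def hits {α : Type*} {n : ℕ} (A : Set α) (v : Fin n → α) : ℕ :=
  (Finset.univ.filter fun i => v i ∈ A).card

-- The product form lets exponential weights factor over coordinates, both under independence and
-- under exchanges of two samples.
open Classical in
theorem prod_ite_mem_eq_pow_hits {α : Type*} {n : ℕ} (A : Set α) (v : Fin n → α) (c : ℝ) :
    ∏ i, (if v i ∈ A then c else 1) = c ^ hits A v := by
  rw [Finset.prod_ite]
  simp [hits]

namespace PMF

variable {α : Type*}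

open Classical in
theorem expect_ofReal_ite (p : PMF α) (A : Set α) {c : ℝ} (hc : 0 ≤ c) :
    p.expect (fun a => ENNReal.ofReal (if a ∈ A then c else 1)) =
      ENNReal.ofReal (1 + (c - 1) * p.pr A) := by
  have h1 : (fun a => ENNReal.ofReal (if a ∈ A then c else 1)) =
      fun a => ENNReal.ofReal c * A.indicator 1 a + Aᶜ.indicator 1 a := by
    ext a
    by_cases h : a ∈ A <;> simp [h]
  rw [h1, expect_add, expect_const_mul, ← ofReal_pr, ← ofReal_pr, ← ENNReal.ofReal_mul hc,
    ← ENNReal.ofReal_add (mul_nonneg hc (p.pr_nonneg _)) (p.pr_nonneg _)]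
  congr 1
  linarith [p.pr_add_compl A]

/-- Exponential moments of the number of hits. -/
theorem expect_pow_hits_le (p : PMF α) (n : ℕ) (A : Set α) {c : ℝ} (hc : 0 ≤ c) :
    (p.iid n).expect (fun v => ENNReal.ofReal (c ^ hits A v)) ≤
      ENNReal.ofReal (Real.exp (n * ((c - 1) * p.pr A))) := by
  classical
  have h : (fun v : Fin n → α => ENNReal.ofReal (c ^ hits A v)) =
      fun v => ∏ i, ENNReal.ofReal (if v i ∈ A then c else 1) := by
    ext v
    rw [← prod_ite_mem_eq_pow_hits, ENNReal.ofReal_prod_of_nonneg]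
    intro i _
    split_ifs <;> positivity
  rw [h, p.expect_iid_prod (fun a => ENNReal.ofReal (if a ∈ A then c else 1)),
    expect_ofReal_ite p A hc, Real.exp_nat_mul, ENNReal.ofReal_pow (Real.exp_pos _).le]
  gcongr
  linarith [Real.add_one_le_exp ((c - 1) * p.pr A)]

/-- Chernoff bound for the upper tail. -/
theorem pr_lt_hits_le (p : PMF α) (n : ℕ) (A : Set α) (s : ℝ) :
    (p.iid n).pr {v | s < hits A v} ≤ Real.exp (n * p.pr A - s * Real.log 2) := by
  refine pr_le_of_expect_le _ _ (Real.exp_pos _).le ?_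
  calc (p.iid n).expect ({v | s < hits A v}.indicator 1)
      ≤ (p.iid n).expect fun v =>
          ENNReal.ofReal (Real.exp (-(s * Real.log 2))) * ENNReal.ofReal (2 ^ hits A v) := by
        refine expect_mono _ fun v => ?_
        refine Set.indicator_apply_le' (fun hv => ?_) fun _ => bot_le
        rw [← ENNReal.ofReal_mul (Real.exp_pos _).le, Pi.one_apply, ENNReal.one_le_ofReal,
          ← Real.rpow_natCast, Real.rpow_def_of_pos two_pos, ← Real.exp_add, Real.one_le_exp_iff]
        have hv' : s < hits A v := hv
        nlinarith [Real.log_pos one_lt_two]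
    _ ≤ _ := by
        rw [expect_const_mul]
        refine (mul_le_mul_right (p.expect_pow_hits_le n A zero_le_two) _).trans ?_
        rw [← ENNReal.ofReal_mul (Real.exp_pos _).le, ← Real.exp_add]
        apply le_of_eq
        congr 2
        ring

/-- Chernoff bound for the lower tail. -/
theorem pr_hits_lt_le_half (p : PMF α) (n : ℕ) (A : Set α) {r : ℝ} (hr : r ≤ p.pr A)
    (hn : 5 ≤ n * r) : (p.iid n).pr {v | (hits A v : ℝ) < n * r / 2} ≤ 1 / 2 := by
  have hlog := Real.log_two_lt_d9
  have hlog' := Real.log_two_gt_d9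
  -- The exponent is at most `-(n * r) * (1 - log 2) / 2`; the assumption `5 ≤ n * r` brings this
  -- below `-log 2`.
  have key : Real.exp (n * r / 2 * Real.log 2 + n * ((1 / 2 - 1) * p.pr A)) ≤ 1 / 2 := by
    rw [← Real.le_log_iff_exp_le (by norm_num), one_div, Real.log_inv]
    have : (n : ℝ) * r ≤ n * p.pr A := by gcongr
    nlinarith
  refine pr_le_of_expect_le _ _ (by norm_num) ?_
  calc (p.iid n).expect ({v | (hits A v : ℝ) < n * r / 2}.indicator 1)
      ≤ (p.iid n).expect fun v =>
          ENNReal.ofReal (Real.exp (n * r / 2 * Real.log 2)) *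
            ENNReal.ofReal ((1 / 2) ^ hits A v) := by
        refine expect_mono _ fun v => ?_
        refine Set.indicator_apply_le' (fun hv => ?_) fun _ => bot_le
        rw [← ENNReal.ofReal_mul (Real.exp_pos _).le, Pi.one_apply, ENNReal.one_le_ofReal,
          ← Real.rpow_natCast, Real.rpow_def_of_pos (by norm_num), ← Real.exp_add,
          Real.one_le_exp_iff, one_div, Real.log_inv]
        have hv' : (hits A v : ℝ) < n * r / 2 := hv
        nlinarith
    _ ≤ _ := by
        rw [expect_const_mul]
        refine (mul_le_mul_right (p.expect_pow_hits_le n A (by norm_num)) _).trans ?_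
        rw [← ENNReal.ofReal_mul (Real.exp_pos _).le, ← Real.exp_add]
        exact ENNReal.ofReal_le_ofReal key

end PMF

/-! ### Natarajan dimension and Natarajan's lemma -/

theorem natarajanShatters_empty {α β : Type*} {F : Set (α → β)} (hF : F.Nonempty) :
    NatarajanShatters F ∅ := by
  obtain ⟨f, hf⟩ := hF
  exact ⟨f, f, by simp, fun B hB => ⟨f, hf, by simp, by simp⟩⟩

theorem NatarajanShatters.card_le {α β : Type*} {F : Set (α → β)} {d : ℕ}
    (hd : natarajanDim F = d) {S : Finset α} (h : NatarajanShatters F S) : S.card ≤ d := by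
  have h1 : (S.card : ℕ∞) ≤ natarajanDim F :=
    le_iSup₂ (f := fun (S : Finset α) (_ : NatarajanShatters F S) => (S.card : ℕ∞)) S h
  rw [hd] at h1
  exact_mod_cast h1

/-- The functions of `F` with value `b` at `x` that agree on `P` with a function of `F` with
value `a` at `x`. -/
def branching {α β : Type*} (F : Set (α → β)) (P : Finset α) (x : α) (a b : β) : Set (α → β) :=
  {f | f ∈ F ∧ f x = b ∧ ∃ g ∈ F, g x = a ∧ ∀ z ∈ P, f z = g z}

/-- Each `f` in the branching class has a twin `g` in `F` that agrees with it on `P` but takes the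
value `a` at `x`. A pattern containing `x` is realized by `f`, any other by the twin. Passing to the
branching class therefore costs one dimension. -/
theorem NatarajanShatters.insert_of_branching {α β : Type*} [DecidableEq α] {F : Set (α → β)}
    {P S : Finset α} {x : α} (hx : x ∉ P) (hS : S ⊆ P) {a b : β} (hab : a ≠ b)
    (h : NatarajanShatters (branching F P x a b) S) : NatarajanShatters F (insert x S) := by
  obtain ⟨f₀, f₁, hne, hB⟩ := h
  have hxS : ∀ z ∈ S, z ≠ x := fun z hz hzx => hx (hzx ▸ hS hz)
  refine ⟨Function.update f₀ x b, Function.update f₁ x a, ?_, fun B hBS => ?_⟩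
  · intro z hz
    rcases Finset.mem_insert.1 hz with rfl | hz
    · simpa using hab.symm
    · simpa [hxS z hz] using hne z hz
  · obtain ⟨f, ⟨hfF, hfb, g, hgF, hga, hfg⟩, hf0, hf1⟩ :=
      hB (B.erase x) (Finset.subset_insert_iff.1 hBS)
    by_cases hxB : x ∈ B
    · refine ⟨f, hfF, fun z hz => ?_, fun z hz hzB => ?_⟩
      · by_cases hzx : z = x
        · simp [hzx, hfb]
        · simpa [hzx] using hf0 z (Finset.mem_erase.2 ⟨hzx, hz⟩)
      · have hzx : z ≠ x := fun h => hzB (h ▸ hxB)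
        have hzS := Finset.mem_of_mem_insert_of_ne hz hzx
        simpa [hzx] using hf1 z hzS fun h => hzB (Finset.mem_of_mem_erase h)
    · rw [Finset.erase_eq_of_notMem hxB] at hf0 hf1
      refine ⟨g, hgF, fun z hz => ?_, fun z hz hzB => ?_⟩
      · have hzx : z ≠ x := fun h => hxB (h ▸ hz)
        have hzS := Finset.mem_of_mem_insert_of_ne (hBS hz) hzx
        rw [← hfg z (hS hzS)]
        simpa [hzx] using hf0 z hz
      · by_cases hzx : z = x
        · simp [hzx, hga]
        · have hzS := Finset.mem_of_mem_insert_of_ne hz hzx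
          rw [← hfg z (hS hzS)]
          simpa [hzx] using hf1 z hzS hzB

/-- Natarajan's lemma: a class that shatters no subset of `P` with more than `d` elements has at
most `((|P| + 1) |β|²) ^ d` distinct restrictions to `P`. -/
theorem exists_finset_cover_of_natarajanShatters {α β : Type*} [Fintype β] [Nonempty β]
    (P : Finset α) : ∀ (d : ℕ) (F : Set (α → β)), (∀ S ⊆ P, NatarajanShatters F S → S.card ≤ d) →
      ∃ G : Finset (α → β), ↑G ⊆ F ∧ G.card ≤ ((P.card + 1) * Fintype.card β ^ 2) ^ d ∧
        ∀ f ∈ F, ∃ g ∈ G, ∀ z ∈ P, f z = g z := by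
  classical
  have hβ : 0 < Fintype.card β := Fintype.card_pos
  induction P using Finset.induction_on with
  | empty =>
    intro d F hF
    rcases F.eq_empty_or_nonempty with rfl | ⟨f, hf⟩
    · exact ⟨∅, by simp, by simp, by simp⟩
    · refine ⟨{f}, by simpa using hf, ?_, fun g _ => ⟨f, by simp, by simp⟩⟩
      rw [Finset.card_singleton]
      exact Nat.one_le_pow _ _ (by positivity)
  | insert x P hx ih =>
    intro d F hF
    -- `G₀` represents the restrictions to `P`. A function that disagrees at `x` with its
    -- representative `g` lies in the branching class of the pair `(g x, f x)`, which has smaller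
    -- dimension on `P`. Summing over pairs of values bounds the count by `N(p, d + 1) + k² N(p,
    -- d)`.
    obtain ⟨G₀, hG₀F, hG₀c, hG₀⟩ :=
      ih d F fun S hS h => hF S (hS.trans (Finset.subset_insert x P)) h
    have hbr : ∀ a b, a ≠ b → ∀ S ⊆ P, NatarajanShatters (branching F P x a b) S →
        S.card + 1 ≤ d := by
      intro a b hab S hS h
      rw [← Finset.card_insert_of_notMem fun hxS => hx (hS hxS)]
      exact hF _ (Finset.insert_subset_insert x hS) (h.insert_of_branching hx hS hab)
    rcases d with _ | d
    · refine ⟨G₀, hG₀F, by simpa using hG₀c, fun f hf => ?_⟩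
      obtain ⟨g, hg, hfg⟩ := hG₀ f hf
      refine ⟨g, hg, fun z hz => ?_⟩
      rcases Finset.mem_insert.1 hz with rfl | hz
      -- For `d = 0` every branching class must be empty, since a nonempty one shatters `∅`.
      · by_contra hne
        have hmem : f ∈ branching F P z (g z) (f z) := ⟨hf, rfl, g, hG₀F hg, rfl, hfg⟩
        have := hbr _ _ (Ne.symm hne) ∅ (Finset.empty_subset _) (natarajanShatters_empty ⟨f, hmem⟩)
        omega
      · exact hfg z hz
    · have hex : ∀ c : β × β, ∃ G : Finset (α → β),
          ↑G ⊆ F ∧ G.card ≤ ((P.card + 1) * Fintype.card β ^ 2) ^ d ∧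
          (c.1 ≠ c.2 → ∀ f ∈ branching F P x c.1 c.2, ∃ g ∈ G, f x = g x ∧ ∀ z ∈ P, f z = g z) := by
        rintro ⟨a, b⟩
        by_cases hab : a = b
        · exact ⟨∅, by simp, by simp, fun h => absurd hab h⟩
        · obtain ⟨G, hGF, hGc, hG⟩ := ih d (branching F P x a b) fun S hS h =>
            Nat.le_of_succ_le_succ (hbr a b hab S hS h)
          refine ⟨G, fun g hg => (hGF hg).1, hGc, fun _ f hf => ?_⟩
          obtain ⟨g, hg, hfg⟩ := hG f hf
          exact ⟨g, hg, hf.2.1.trans (hGF hg).2.1.symm, hfg⟩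
      choose G hGF hGc hG using hex
      refine ⟨G₀ ∪ Finset.univ.biUnion G, ?_, ?_, fun f hf => ?_⟩
      · intro g hg
        rcases Finset.mem_union.1 (Finset.mem_coe.1 hg) with hg | hg
        · exact hG₀F hg
        · obtain ⟨c, -, hc⟩ := Finset.mem_biUnion.1 hg
          exact hGF c hc
      · rw [Finset.card_insert_of_notMem hx]
        set k := Fintype.card β
        set p := P.card
        have h1 : (Finset.univ.biUnion G).card ≤ k ^ 2 * ((p + 1) * k ^ 2) ^ d := by
          refine (Finset.card_biUnion_le_card_mul _ _ _ fun c _ => hGc c).trans ?_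
          simp [k, sq]
        refine (Finset.card_union_le _ _).trans ((Nat.add_le_add hG₀c h1).trans ?_)
        calc ((p + 1) * k ^ 2) ^ (d + 1) + k ^ 2 * ((p + 1) * k ^ 2) ^ d
            = ((p + 1) * k ^ 2) ^ d * ((p + 1 + 1) * k ^ 2) := by ring
          _ ≤ ((p + 1 + 1) * k ^ 2) ^ d * ((p + 1 + 1) * k ^ 2) := by gcongr; omega
          _ = _ := (pow_succ _ _).symm
      · obtain ⟨g, hg, hfg⟩ := hG₀ f hf
        by_cases hgx : f x = g x
        · refine ⟨g, Finset.mem_union_left _ hg, fun z hz => ?_⟩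
          rcases Finset.mem_insert.1 hz with rfl | hz
          exacts [hgx, hfg z hz]
        · obtain ⟨g', hg', hx', hfg'⟩ := hG (g x, f x) (Ne.symm hgx) f
            ⟨hf, rfl, g, hG₀F hg, rfl, hfg⟩
          refine ⟨g', Finset.mem_union_right _ (Finset.mem_biUnion.2 ⟨_, Finset.mem_univ _, hg'⟩),
            fun z hz => ?_⟩
          rcases Finset.mem_insert.1 hz with rfl | hz
          exacts [hx', hfg' z hz]

/-- Two functions that differ at `x` shatter `{x}`. This settles the degenerate case of the main
theorem without any statistics. -/
theorem eq_of_natarajanDim_eq_zero {α β : Type*} {F : Set (α → β)} (hd : natarajanDim F = 0)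
    {f g : α → β} (hf : f ∈ F) (hg : g ∈ F) : f = g := by
  classical
  by_contra hne
  obtain ⟨x, hx⟩ := Function.ne_iff.1 hne
  have h : NatarajanShatters F {x} := by
    refine ⟨f, g, by simpa using hx, fun B hB => ?_⟩
    by_cases hxB : x ∈ B
    · refine ⟨f, hf, fun _ _ => rfl, fun z hz hzB => ?_⟩
      exact absurd (Finset.mem_singleton.1 hz ▸ hxB) hzB
    · exact ⟨g, hg, fun z hz => absurd (Finset.mem_singleton.1 (hB hz) ▸ hz) hxB, fun _ _ _ => rfl⟩
  simpa using h.card_le (d := 0) (by simpa using hd)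

/-! ### Symmetrization and the multiplicative deviation bound -/

theorem hits_congr {α : Type*} {n : ℕ} {A B : Set α} {v : Fin n → α}
    (h : ∀ j, v j ∈ A ↔ v j ∈ B) : hits A v = hits B v := by
  simp only [hits]
  congr 1
  ext j
  simp [h]

/-- Averaged over random exchanges of two samples, the weight `(1/2)^k (3/2)^l`, where `k` and `l`
are the numbers of hits in the two samples, is at most one. -/
theorem sum_swap_weight_le {α : Type*} {n : ℕ} (A : Set α) (v w : Fin n → α) :
    ∑ σ : Fin n → Bool,
      ((1 / 2 : ℝ) ^ hits A (fun i => if σ i then w i else v i) *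
        (3 / 2 : ℝ) ^ hits A (fun i => if σ i then v i else w i)) ≤ 2 ^ n := by
  classical
  let f : Fin n → Bool → ℝ := fun i b =>
    (if (if b then w i else v i) ∈ A then (1 / 2 : ℝ) else 1) *
      (if (if b then v i else w i) ∈ A then (3 / 2 : ℝ) else 1)
  have h : ∀ σ : Fin n → Bool,
      ((1 / 2 : ℝ) ^ hits A (fun i => if σ i then w i else v i) *
        (3 / 2 : ℝ) ^ hits A (fun i => if σ i then v i else w i)) = ∏ i, f i (σ i) := by
    intro σ
    rw [← prod_ite_mem_eq_pow_hits, ← prod_ite_mem_eq_pow_hits, ← Finset.prod_mul_distrib]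
  simp only [h]
  rw [← Fintype.piFinset_univ, ← Finset.prod_univ_sum (fun _ => Finset.univ) f]
  calc ∏ i, ∑ b, f i b ≤ ∏ _i : Fin n, (2 : ℝ) := by
        refine Finset.prod_le_prod (fun i _ => Finset.sum_nonneg fun b _ => ?_) fun i _ => ?_
        · simp only [f]
          split_ifs <;> norm_num
        · simp only [f, Fintype.sum_bool]
          -- The two exchange choices sum to `3/4 + 3/4` if both points lie in `A`, to `1/2 + 3/2`
          -- if exactly one does, and to `1 + 1` if none does.
          by_cases h1 : v i ∈ A <;> by_cases h2 : w i ∈ A <;> simp [h1, h2] <;> norm_num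
    _ = 2 ^ n := by simp

namespace PMF

variable {α ι : Type*}

/-- The joint law of the samples is invariant under all `2 ^ n` exchanges, so one may average over
them. For fixed `v` and `w`, exchanges create no new points: the supremum is at most a sum over the
same `N` representatives, and each of them has average weight at most one. -/
theorem expect_iSup_swap_weight_le (p : PMF α) (I : Set ι) (A : ι → Set α) (n N : ℕ)
    (hcov : ∀ v w : Fin n → α, ∃ G : Finset ι, G.card ≤ N ∧ ∀ i ∈ I, ∃ g ∈ G,
      ∀ j, (v j ∈ A i ↔ v j ∈ A g) ∧ (w j ∈ A i ↔ w j ∈ A g)) :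
    ((p.iid n).expect fun v => (p.iid n).expect fun w => ⨆ i ∈ I,
      ENNReal.ofReal ((1 / 2) ^ hits (A i) v * (3 / 2) ^ hits (A i) w)) ≤ N := by
  set Φ : (Fin n → α) → (Fin n → α) → ℝ≥0∞ := fun v w => ⨆ i ∈ I,
      ENNReal.ofReal ((1 / 2) ^ hits (A i) v * (3 / 2) ^ hits (A i) w)
  have hpt : ∀ v w : Fin n → α, ∑ σ : Fin n → Bool,
      Φ (fun i => if σ i then w i else v i) (fun i => if σ i then v i else w i) ≤ 2 ^ n * N := by
    intro v w
    obtain ⟨G, hGN, hG⟩ := hcov v w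
    calc ∑ σ : Fin n → Bool,
          Φ (fun i => if σ i then w i else v i) (fun i => if σ i then v i else w i)
        ≤ ∑ σ : Fin n → Bool, ∑ g ∈ G, ENNReal.ofReal
            ((1 / 2) ^ hits (A g) (fun i => if σ i then w i else v i) *
              (3 / 2) ^ hits (A g) (fun i => if σ i then v i else w i)) := by
          refine Finset.sum_le_sum fun σ _ => iSup₂_le fun i hi => ?_
          obtain ⟨g, hg, hig⟩ := hG i hi
          rw [hits_congr (A := A i) (B := A g), hits_congr (A := A i) (B := A g)]
          · exact Finset.single_le_sum (f := fun g => ENNReal.ofReal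
              ((1 / 2) ^ hits (A g) (fun i => if σ i then w i else v i) *
                (3 / 2) ^ hits (A g) (fun i => if σ i then v i else w i)))
              (fun _ _ => bot_le) hg
          · intro j
            by_cases h : σ j <;> simp [h, hig j]
          · intro j
            by_cases h : σ j <;> simp [h, hig j]
      _ = ∑ g ∈ G, ENNReal.ofReal (∑ σ : Fin n → Bool,
            ((1 / 2) ^ hits (A g) (fun i => if σ i then w i else v i) *
              (3 / 2) ^ hits (A g) (fun i => if σ i then v i else w i))) := by
          rw [Finset.sum_comm]
          refine Finset.sum_congr rfl fun g _ => (ENNReal.ofReal_sum_of_nonneg fun σ _ => ?_).symm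
          positivity
      _ ≤ ∑ _g ∈ G, (2 : ℝ≥0∞) ^ n := by
          refine Finset.sum_le_sum fun g _ => ?_
          refine (ENNReal.ofReal_le_ofReal (sum_swap_weight_le (A g) v w)).trans ?_
          rw [ENNReal.ofReal_pow zero_le_two, ENNReal.ofReal_ofNat]
      _ ≤ 2 ^ n * N := by
          rw [Finset.sum_const, nsmul_eq_mul, mul_comm]
          gcongr
  have hsum : (2 : ℝ≥0∞) ^ n * ((p.iid n).expect fun v => (p.iid n).expect fun w => Φ v w) ≤
      2 ^ n * N := by
    calc (2 : ℝ≥0∞) ^ n * ((p.iid n).expect fun v => (p.iid n).expect fun w => Φ v w)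
        = ∑ _σ : Fin n → Bool, (p.iid n).expect fun v => (p.iid n).expect fun w => Φ v w := by
          simp
      _ = (p.iid n).expect fun v => (p.iid n).expect fun w => ∑ σ : Fin n → Bool,
            Φ (fun i => if σ i then w i else v i) (fun i => if σ i then v i else w i) := by
          simp only [expect_finset_sum]
          exact Finset.sum_congr rfl fun σ _ => p.expect_iid_swap n σ Φ
      _ ≤ (p.iid n).expect fun _ => (p.iid n).expect fun _ => 2 ^ n * N :=
          expect_mono _ fun v => expect_mono _ fun w => hpt v w
      _ = 2 ^ n * N := by simp
  exact (ENNReal.mul_le_mul_iff_right (by simp) (by simp)).1 hsum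

/-- Uniform relative deviation bound: if any two samples of size `n` see at most `N` traces of the
sets `A i`, then it is unlikely that some set of probability at least `r` is hit at most `s`
times. -/
theorem pr_exists_hits_le (p : PMF α) (I : Set ι) (A : ι → Set α) (n N : ℕ) (r s : ℝ)
    (hcov : ∀ v w : Fin n → α, ∃ G : Finset ι, G.card ≤ N ∧ ∀ i ∈ I, ∃ g ∈ G,
      ∀ j, (v j ∈ A i ↔ v j ∈ A g) ∧ (w j ∈ A i ↔ w j ∈ A g))
    (hn : 5 ≤ n * r) :
    (p.iid n).pr {v | ∃ i ∈ I, r ≤ p.pr (A i) ∧ (hits (A i) v : ℝ) ≤ s} ≤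
      2 * N * Real.exp (s * Real.log 2 - n * r / 2 * Real.log (3 / 2)) := by
  -- Chosen so that `c * (1/2)^s * (3/2)^(n * r / 2) = 1`.
  set c := Real.exp (s * Real.log 2 - n * r / 2 * Real.log (3 / 2)) with hc
  have hc0 : 0 < c := Real.exp_pos _
  refine pr_le_of_expect_le _ _ (by positivity) ?_
  set Φ : (Fin n → α) → (Fin n → α) → ℝ≥0∞ := fun v w => ⨆ i ∈ I,
      ENNReal.ofReal ((1 / 2) ^ hits (A i) v * (3 / 2) ^ hits (A i) w)
  calc (p.iid n).expect
        ({v | ∃ i ∈ I, r ≤ p.pr (A i) ∧ (hits (A i) v : ℝ) ≤ s}.indicator 1)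
      ≤ (p.iid n).expect fun v => 2 * (p.iid n).expect fun w => ENNReal.ofReal c * Φ v w := by
        refine expect_mono _ fun v => ?_
        refine Set.indicator_apply_le' (fun hv => ?_) fun _ => bot_le
        obtain ⟨i, hi, hir, his⟩ := hv
        have hhalf := p.pr_hits_lt_le_half n (A i) hir hn
        have hhalf' : 1 / 2 ≤ (p.iid n).pr {w | (hits (A i) w : ℝ) < n * r / 2}ᶜ := by
          linarith [(p.iid n).pr_add_compl {w | (hits (A i) w : ℝ) < n * r / 2}]
        -- With `v` fixed, the ghost sample `w` hits `A i` at least `n * r / 2` times with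
        -- probability at least one half, and then `c * Φ v w ≥ 1`. The index `i` may depend on `v`
        -- because `Φ` is a supremum.
        have h1 : ENNReal.ofReal (1 / 2) ≤
            (p.iid n).expect fun w => ENNReal.ofReal c * Φ v w := by
          refine (ENNReal.ofReal_le_ofReal hhalf').trans ?_
          rw [ofReal_pr]
          refine expect_mono _ fun w => ?_
          refine Set.indicator_apply_le' (fun hw => ?_) fun _ => bot_le
          refine le_trans ?_ (mul_le_mul_right (le_iSup₂ (f := fun i (_ : i ∈ I) =>
            ENNReal.ofReal ((1 / 2) ^ hits (A i) v * (3 / 2) ^ hits (A i) w)) i hi) _)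
          have hw' : n * r / 2 ≤ hits (A i) w := not_lt.1 hw
          rw [← ENNReal.ofReal_mul hc0.le, Pi.one_apply, ENNReal.one_le_ofReal, hc,
            ← Real.rpow_natCast, ← Real.rpow_natCast, Real.rpow_def_of_pos (by norm_num),
            Real.rpow_def_of_pos (by norm_num), ← Real.exp_add, ← Real.exp_add,
            Real.one_le_exp_iff, one_div, Real.log_inv]
          have l1 : 0 < Real.log 2 := Real.log_pos one_lt_two
          have l2 : 0 < Real.log (3 / 2) := Real.log_pos (by norm_num)
          nlinarith
        calc (1 : ℝ≥0∞) = 2 * ENNReal.ofReal (1 / 2) := by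
              rw [← ENNReal.ofReal_ofNat, ← ENNReal.ofReal_mul zero_le_two]
              norm_num
          _ ≤ _ := mul_le_mul_right h1 _
    _ = 2 * (ENNReal.ofReal c * (p.iid n).expect fun v => (p.iid n).expect fun w => Φ v w) := by
        simp only [expect_const_mul]
    _ ≤ 2 * (ENNReal.ofReal c * N) := by
        gcongr
        exact p.expect_iSup_swap_weight_le I A n N hcov
    _ = ENNReal.ofReal (2 * N * c) := by
        rw [ENNReal.ofReal_mul (by positivity), ENNReal.ofReal_mul zero_le_two,
          ENNReal.ofReal_natCast, ENNReal.ofReal_ofNat]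
        ring

end PMF

/-! ### Semantics of oracle programs: results and call counts -/

namespace OracleProg

variable {X Y A α β : Type*} (πref : X → PMF Y) (V : X → A → Bool)

/-- The distribution of the result of a program. -/
noncomputable def resultLaw (p : OracleProg X Y A α) : PMF α :=
  (p.run πref V).map Execution.result

@[simp] theorem resultLaw_pure (a : α) :
    (OracleProg.pure a : OracleProg X Y A α).resultLaw πref V = PMF.pure a := by
  simp [resultLaw, run, PMF.pure_map]

@[simp] theorem resultLaw_rollout (x : X) (k : Y → ℝ → OracleProg X Y A α) :
    (OracleProg.rollout x k).resultLaw πref V =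
      (πref x).bind fun y => (k y (πref x y).toReal).resultLaw πref V := by
  simp only [resultLaw, run, PMF.map_bind, PMF.map_comp]
  rfl

@[simp] theorem resultLaw_verify (x : X) (a : A) (k : Bool → OracleProg X Y A α) :
    (OracleProg.verify x a k).resultLaw πref V = (k (V x a)).resultLaw πref V := by
  simp only [resultLaw, run, PMF.map_comp]
  rfl

theorem resultLaw_bind (p : OracleProg X Y A α) (f : α → OracleProg X Y A β) :
    (p.bind f).resultLaw πref V =
      (p.resultLaw πref V).bind fun a => (f a).resultLaw πref V := by
  induction p with
  | pure a => simp [bind]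
  | rollout x k ih => simp [bind, ih]
  | verify x a k ih => simp [bind, ih]

/-- Call counts add up along each possible execution. Working on the support is enough, as the
bounds on the calls hold for every execution. -/
theorem exists_of_mem_support_run_bind (p : OracleProg X Y A α) (f : α → OracleProg X Y A β) :
    ∀ e ∈ ((p.bind f).run πref V).support, ∃ e₁ ∈ (p.run πref V).support,
      ∃ e₂ ∈ ((f e₁.result).run πref V).support,
        e.rollouts = e₁.rollouts + e₂.rollouts ∧
          e.verifierCalls = e₁.verifierCalls + e₂.verifierCalls := by
  induction p with
  | pure a =>
    intro e he
    exact ⟨⟨a, 0, 0⟩, by simp [run], e, he, by simp, by simp⟩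
  | rollout x k ih =>
    intro e he
    simp only [bind, run, PMF.support_bind, PMF.support_map, Set.mem_iUnion, Set.mem_image] at he
    obtain ⟨y, hy, e', he', rfl⟩ := he
    obtain ⟨e₁, h₁, e₂, h₂, hr, hv⟩ := ih _ _ e' he'
    refine ⟨{ e₁ with rollouts := e₁.rollouts + 1 }, ?_, e₂, h₂, ?_, hv⟩
    · simp only [run, PMF.support_bind, PMF.support_map, Set.mem_iUnion, Set.mem_image]
      exact ⟨y, hy, e₁, h₁, rfl⟩
    · simp only [hr]
      omega
  | verify x a k ih =>
    intro e he
    simp only [bind, run, PMF.support_map, Set.mem_image] at he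
    obtain ⟨e', he', rfl⟩ := he
    obtain ⟨e₁, h₁, e₂, h₂, hr, hv⟩ := ih _ e' he'
    refine ⟨{ e₁ with verifierCalls := e₁.verifierCalls + 1 }, ?_, e₂, h₂, hr, ?_⟩
    · simp only [run, PMF.support_map, Set.mem_image]
      exact ⟨e₁, h₁, rfl⟩
    · simp only [hv]
      omega

end OracleProg

/-! ### Rejection sampling -/

section

variable {Tok : Type*} {X : Set (TokenString Tok)} {T : ℕ} [NeZero T]
  (πref : X → PMF (Response Tok T)) (V : X → Tok → Bool)

theorem rejectionSample_calls (C : ℝ) (x : X) (m : ℕ) :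
    ∀ e ∈ ((rejectionSample C x m).run πref V).support,
      e.rollouts = m ∧ e.verifierCalls = m := by
  induction m with
  | zero =>
    intro e he
    simp only [rejectionSample, OracleProg.run, PMF.support_pure, Set.mem_singleton_iff] at he
    simp [he]
  | succ m ih =>
    intro e he
    simp only [rejectionSample, OracleProg.run, PMF.support_bind, PMF.support_map, Set.mem_iUnion,
      Set.mem_image] at he
    obtain ⟨y, -, _, ⟨e', he', rfl⟩, rfl⟩ := he
    obtain ⟨e₁, h₁, e₂, h₂, hr, hv⟩ := OracleProg.exists_of_mem_support_run_bind _ _ _ _ e' he'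
    simp only [OracleProg.run, PMF.support_pure, Set.mem_singleton_iff] at h₂
    obtain ⟨hr₁, hv₁⟩ := ih e₁ h₁
    simp [hr, hv, h₂, hr₁, hv₁]

theorem rejectionSampleAll_calls (C : ℝ) (m : ℕ) : ∀ {n : ℕ} (xs : Fin n → X),
    ∀ e ∈ ((rejectionSampleAll C m xs).run πref V).support,
      e.rollouts = n * m ∧ e.verifierCalls = n * m
  | 0, xs => by
    intro e he
    simp only [rejectionSampleAll, OracleProg.run, PMF.support_pure, Set.mem_singleton_iff] at he
    simp [he]
  | n + 1, xs => by
    intro e he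
    rw [rejectionSampleAll] at he
    obtain ⟨e₁, h₁, e', he', hr, hv⟩ := OracleProg.exists_of_mem_support_run_bind _ _ _ _ e he
    obtain ⟨e₂, h₂, e₃, h₃, hr', hv'⟩ := OracleProg.exists_of_mem_support_run_bind _ _ _ _ e' he'
    simp only [OracleProg.run, PMF.support_pure, Set.mem_singleton_iff] at h₃
    obtain ⟨hr₁, hv₁⟩ := rejectionSample_calls πref V C _ m e₁ h₁
    obtain ⟨hr₂, hv₂⟩ := rejectionSampleAll_calls C m _ e₂ h₂
    rw [hr, hv, hr', hv', hr₁, hv₁, hr₂, hv₂, h₃]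
    constructor <;> ring

theorem rlFineTune_calls {n : ℕ}
    (erm : (Fin n → X) → (Fin n → Finset (Response Tok T)) → NextTokenModel Tok)
    (C δ : ℝ) (xs : Fin n → X) : ∀ e ∈ ((rlFineTune erm C δ xs).run πref V).support,
      e.rollouts = n * rolloutsPerPrompt n C δ ∧ e.verifierCalls = n * rolloutsPerPrompt n C δ := by
  intro e he
  obtain ⟨e₁, h₁, e₂, h₂, hr, hv⟩ := OracleProg.exists_of_mem_support_run_bind _ _ _ _ e he
  simp only [OracleProg.run, PMF.support_pure, Set.mem_singleton_iff] at h₂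
  obtain ⟨hr₁, hv₁⟩ := rejectionSampleAll_calls πref V C _ xs e₁ h₁
  simp [hr, hv, h₂, hr₁, hv₁]

/-- The responses with a correct answer and with probability at least `C⁻¹` under the reference
model. -/
def acceptedSet (C : ℝ) (x : X) : Set (Response Tok T) :=
  {y | C⁻¹ ≤ (πref x y).toReal ∧ V x y.answer = true}

open Classical in
theorem resultLaw_rejectionSample_succ (C : ℝ) (x : X) (m : ℕ) :
    (rejectionSample C x (m + 1)).resultLaw πref V =
      (πref x).bind fun y => ((rejectionSample C x m).resultLaw πref V).map fun D =>
        if y ∈ acceptedSet πref V C x then insert y D else D := by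
  simp only [rejectionSample, OracleProg.resultLaw_rollout, OracleProg.resultLaw_verify,
    OracleProg.resultLaw_bind, OracleProg.resultLaw_pure]
  refine congrArg _ (funext fun y => ?_)
  rw [PMF.map]
  refine congrArg _ (funext fun D => congrArg PMF.pure ?_)
  exact if_congr Iff.rfl rfl rfl

theorem subset_acceptedSet_of_mem_support (C : ℝ) (x : X) (m : ℕ) :
    ∀ D ∈ ((rejectionSample C x m).resultLaw πref V).support,
      (D : Set (Response Tok T)) ⊆ acceptedSet πref V C x := by
  classical
  induction m with
  | zero =>
    intro D hD
    simp only [rejectionSample, OracleProg.resultLaw_pure, PMF.support_pure,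
      Set.mem_singleton_iff] at hD
    simp [hD]
  | succ m ih =>
    intro D hD
    simp only [resultLaw_rejectionSample_succ, PMF.support_bind, PMF.support_map, Set.mem_iUnion,
      Set.mem_image] at hD
    obtain ⟨y, -, D', hD', rfl⟩ := hD
    split_ifs with hy
    · rw [Finset.coe_insert]
      exact Set.insert_subset hy (ih D' hD')
    · exact ih D' hD'

/-- An accepted `y` is missed only if all `m` independent draws differ from it. -/
theorem expect_notMem_rejectionSample (C : ℝ) (x : X) {y : Response Tok T}
    (hy : y ∈ acceptedSet πref V C x) (m : ℕ) :
    ((rejectionSample C x m).resultLaw πref V).expect ({D | y ∉ D}.indicator 1) ≤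
      ((πref x).expect (({y}ᶜ : Set (Response Tok T)).indicator 1)) ^ m := by
  classical
  induction m with
  | zero => simp [rejectionSample]
  | succ m ih =>
    rw [resultLaw_rejectionSample_succ, PMF.expect_bind, pow_succ']
    simp only [PMF.expect_map]
    calc ((πref x).expect fun z => ((rejectionSample C x m).resultLaw πref V).expect
            (({D | y ∉ D}.indicator 1) ∘ fun D =>
              if z ∈ acceptedSet πref V C x then insert z D else D))
        ≤ (πref x).expect fun z => ({y}ᶜ : Set (Response Tok T)).indicator 1 z *
            ((rejectionSample C x m).resultLaw πref V).expect ({D | y ∉ D}.indicator 1) := by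
          refine PMF.expect_mono _ fun z => ?_
          rw [← PMF.expect_const_mul]
          refine PMF.expect_mono _ fun D => ?_
          by_cases hzy : z = y
          · simp [hzy, hy]
          · by_cases hz : z ∈ acceptedSet πref V C x <;> by_cases hyD : y ∈ D <;>
              simp [hz, hyD, hzy, Ne.symm hzy]
      _ ≤ _ := by
          rw [PMF.expect_mul_const]
          gcongr

theorem sum_toReal_le_one {α : Type*} (p : PMF α) (s : Finset α) :
    ∑ a ∈ s, (p a).toReal ≤ 1 := by
  rw [← ENNReal.toReal_sum fun a _ => p.apply_ne_top a]
  exact ENNReal.toReal_le_of_le_ofReal zero_le_one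
    (by simpa [p.tsum_coe] using ENNReal.sum_le_tsum (f := p) s)

/-- Each accepted response carries mass at least `C⁻¹`, and the total mass is at most one. -/
theorem ncard_acceptedSet_le [Finite Tok] {C : ℝ} (hC : 0 < C) (x : X) :
    ((acceptedSet πref V C x).ncard : ℝ) ≤ C := by
  have hfin : (acceptedSet πref V C x).Finite := Set.toFinite _
  rw [Set.ncard_eq_toFinset_card _ hfin]
  have h1 : (hfin.toFinset.card : ℝ) * C⁻¹ ≤ ∑ y ∈ hfin.toFinset, (πref x y).toReal := by
    rw [← nsmul_eq_mul]
    exact Finset.card_nsmul_le_sum _ _ _ fun y hy => ((Set.Finite.mem_toFinset hfin).1 hy).1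
  have h2 := h1.trans (sum_toReal_le_one (πref x) _)
  rwa [← div_eq_mul_inv, div_le_one hC] at h2

theorem expect_notMem_rejectionSample_le_exp {C : ℝ} (x : X) {y : Response Tok T}
    (hy : y ∈ acceptedSet πref V C x) (m : ℕ) :
    ((rejectionSample C x m).resultLaw πref V).expect ({D | y ∉ D}.indicator 1) ≤
      ENNReal.ofReal (Real.exp (-(m * C⁻¹))) := by
  refine (expect_notMem_rejectionSample πref V C x hy m).trans ?_
  have h1 : (πref x).pr {y} = (πref x y).toReal := by
    simp [PMF.pr, PMF.toOuterMeasure_apply_singleton]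
  have h2 := (πref x).pr_add_compl {y}
  rw [← PMF.ofReal_pr, neg_mul_eq_mul_neg, Real.exp_nat_mul,
    ENNReal.ofReal_pow (Real.exp_pos _).le]
  gcongr
  have h3 : C⁻¹ ≤ (πref x y).toReal := hy.1
  linarith [Real.add_one_le_exp (-C⁻¹)]

/-- Only accepted responses are ever collected, so a wrong output must miss one of them; a union
bound over at most `C` of them concludes. -/
theorem expect_rejectionSample_ne [Finite Tok] {C : ℝ} (hC : 0 < C) (x : X) (m : ℕ) :
    ((rejectionSample C x m).resultLaw πref V).expect
        (({D | (D : Set (Response Tok T)) ≠ acceptedSet πref V C x} :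
          Set (Finset (Response Tok T))).indicator 1) ≤
      ENNReal.ofReal (C * Real.exp (-(m * C⁻¹))) := by
  have hfin : (acceptedSet πref V C x).Finite := Set.toFinite _
  calc _ ≤ ((rejectionSample C x m).resultLaw πref V).expect fun D =>
        ∑ y ∈ hfin.toFinset, ({D | y ∉ D} : Set (Finset (Response Tok T))).indicator 1 D := by
        refine PMF.expect_mono_support _ fun D hD => ?_
        refine Set.indicator_apply_le' (fun hne => ?_) fun _ => bot_le
        have hsub := subset_acceptedSet_of_mem_support πref V C x m D hD
        obtain ⟨y, hy, hyD⟩ := Set.not_subset.1 fun h => hne (hsub.antisymm h)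
        refine le_trans ?_ (Finset.single_le_sum
          (f := fun y => ({D | y ∉ D} : Set (Finset (Response Tok T))).indicator 1 D)
          (fun _ _ => bot_le) (hfin.mem_toFinset.2 hy))
        have hyD' : y ∉ D := hyD
        simp [hyD']
    _ ≤ ∑ _y ∈ hfin.toFinset, ENNReal.ofReal (Real.exp (-(m * C⁻¹))) := by
        rw [PMF.expect_finset_sum]
        exact Finset.sum_le_sum fun y hy =>
          expect_notMem_rejectionSample_le_exp πref V x (hfin.mem_toFinset.1 hy) m
    _ ≤ _ := by
        rw [Finset.sum_const, nsmul_eq_mul, ← ENNReal.ofReal_natCast,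
          ← ENNReal.ofReal_mul (Nat.cast_nonneg _)]
        refine ENNReal.ofReal_le_ofReal (mul_le_mul_of_nonneg_right ?_ (Real.exp_pos _).le)
        rw [← Set.ncard_eq_toFinset_card _ hfin]
        exact ncard_acceptedSet_le πref V hC x

theorem expect_rejectionSampleAll_ne [Finite Tok] {C : ℝ} (hC : 0 < C) (m : ℕ) :
    ∀ {n : ℕ} (xs : Fin n → X), ((rejectionSampleAll C m xs).resultLaw πref V).expect
        ({Ds | ∃ i, (Ds i : Set (Response Tok T)) ≠ acceptedSet πref V C (xs i)}.indicator 1) ≤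
      n * ENNReal.ofReal (C * Real.exp (-(m * C⁻¹)))
  | 0, xs => by simp [rejectionSampleAll]
  | n + 1, xs => by
    rw [rejectionSampleAll]
    simp only [OracleProg.resultLaw_bind, OracleProg.resultLaw_pure, PMF.expect_bind,
      PMF.expect_pure]
    calc _ ≤ ((rejectionSample C (xs 0) m).resultLaw πref V).expect fun D =>
          ((rejectionSampleAll C m fun i => xs i.succ).resultLaw πref V).expect fun Ds =>
            ({D | (D : Set (Response Tok T)) ≠ acceptedSet πref V C (xs 0)} :
              Set (Finset (Response Tok T))).indicator 1 D +
            ({Ds | ∃ i, (Ds i : Set (Response Tok T)) ≠ acceptedSet πref V C (xs i.succ)} :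
              Set (Fin n → Finset (Response Tok T))).indicator 1 Ds := by
          refine PMF.expect_mono _ fun D => PMF.expect_mono _ fun Ds => ?_
          refine Set.indicator_apply_le' (fun hne => ?_) fun _ => bot_le
          obtain ⟨i, hi⟩ := hne
          refine Fin.cases (fun h0 => ?_) (fun i hi => ?_) i hi
          · refine le_add_right ?_
            rw [Set.indicator_of_mem]
            · rfl
            · simpa using h0
          · refine le_add_left ?_
            rw [Set.indicator_of_mem]
            · rfl
            · exact ⟨i, by simpa using hi⟩
      _ ≤ _ := by
          simp only [PMF.expect_add, PMF.expect_const]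
          refine (add_le_add (expect_rejectionSample_ne πref V hC (xs 0) m)
            (expect_rejectionSampleAll_ne hC m fun i => xs i.succ)).trans (le_of_eq ?_)
          push_cast
          ring

/-- With probability at least `1 - δ / 4`, rejection sampling finds, on all prompts, all the
accepted responses. -/
theorem expect_rejectionSampleAll_rolloutsPerPrompt_ne [Finite Tok] {C δ : ℝ} (hC : 0 < C)
    (hδ : 0 < δ) {n : ℕ} (hn : 0 < n) (xs : Fin n → X) :
    ((rejectionSampleAll C (rolloutsPerPrompt n C δ) xs).resultLaw πref V).expect
        ({Ds | ∃ i, (Ds i : Set (Response Tok T)) ≠ acceptedSet πref V C (xs i)}.indicator 1) ≤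
      ENNReal.ofReal (δ / 4) := by
  refine (expect_rejectionSampleAll_ne πref V hC _ xs).trans ?_
  rw [← ENNReal.ofReal_natCast, ← ENNReal.ofReal_mul (Nat.cast_nonneg _)]
  refine ENNReal.ofReal_le_ofReal ?_
  have hn' : (0 : ℝ) < n := Nat.cast_pos.2 hn
  have h1 : Real.log (4 * n * C / δ) ≤ rolloutsPerPrompt n C δ * C⁻¹ := by
    rw [← div_eq_mul_inv, le_div_iff₀ hC, mul_comm]
    exact Nat.le_ceil _
  have h2 : Real.exp (-(rolloutsPerPrompt n C δ * C⁻¹)) ≤ δ / (4 * n * C) := by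
    calc _ ≤ Real.exp (-Real.log (4 * n * C / δ)) := Real.exp_le_exp.2 (neg_le_neg h1)
      _ = δ / (4 * n * C) := by
        rw [Real.exp_neg, Real.exp_log (by positivity), inv_div]
  calc (n : ℝ) * (C * Real.exp (-(rolloutsPerPrompt n C δ * C⁻¹)))
      ≤ n * (C * (δ / (4 * n * C))) := by gcongr
    _ = δ / 4 := by field_simp

/-- Since `n * C / δ ≥ 2`, both the `log 4` and the `1` lost to the ceiling are absorbed by
multiples of `log (n * C / δ)`. -/
theorem rolloutsPerPrompt_le {n : ℕ} {C δ : ℝ} (hn : 2 ≤ n) (hC : 1 ≤ C) (hδ : 0 < δ)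
    (hδ1 : δ < 1) : (rolloutsPerPrompt n C δ : ℝ) ≤ 5 * (C * Real.log (n * C / δ)) := by
  have hn' : (2 : ℝ) ≤ n := by exact_mod_cast hn
  have h2 : 2 ≤ n * C / δ := by
    rw [le_div_iff₀ hδ]
    nlinarith
  have hlog : Real.log 2 ≤ Real.log (n * C / δ) := Real.log_le_log two_pos h2
  have hlog2 := Real.log_two_gt_d9
  have h4 : Real.log (4 * n * C / δ) = 2 * Real.log 2 + Real.log (n * C / δ) := by
    rw [show 4 * (n : ℝ) * C / δ = 2 ^ 2 * (n * C / δ) by ring,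
      Real.log_mul (by norm_num) (by positivity), Real.log_pow]
    norm_num
  have hceil : (rolloutsPerPrompt n C δ : ℝ) < C * Real.log (4 * n * C / δ) + 1 := by
    refine Nat.ceil_lt_add_one ?_
    rw [h4]
    nlinarith
  rw [h4] at hceil
  nlinarith

end

/-! ### Chains of thought and their membership patterns -/

section

variable {Tok : Type*} {T : ℕ}

/-- The prompt `x` followed by the first `t` tokens of the response `y`. -/
def Response.prefixString (x : TokenString Tok) (y : Response Tok T) (t : ℕ) : TokenString Tok :=
  x.append (Stream'.Seq.ofList ((List.ofFn y).take t))

theorem Response.take_ofFn_succ (y : Response Tok T) (t : Fin T) :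
    (List.ofFn y).take (t + 1) = (List.ofFn y).take t ++ [y t] := by
  rw [List.take_add_one]
  simp

/-- By induction on the length, the decoded prefix coincides with that of `y` as long as every next
token does. The strings on the right depend on `y` alone, not on `π`, which removes the
autoregressive feedback. -/
theorem NextTokenModel.cot_eq_iff (π : NextTokenModel Tok) (x : TokenString Tok)
    (y : Response Tok T) :
    π.cot T x = y ↔ ∀ t : Fin T, π (y.prefixString x t) = y t := by
  constructor
  · rintro h t
    have hdec : ∀ s ≤ T, π.decode x s = (List.ofFn y).take s := by
      intro s hs
      induction s with
      | zero => simp [decode]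
      | succ s ih =>
        have h1 := congrFun h ⟨s, hs⟩
        simp only [cot] at h1
        rw [decode, h1, ih (Nat.le_of_succ_le hs)]
        exact (y.take_ofFn_succ ⟨s, hs⟩).symm
    have h2 := congrFun h t
    simp only [cot] at h2
    rwa [hdec t t.2.le] at h2
  · intro h
    have hdec : ∀ s ≤ T, π.decode x s = (List.ofFn y).take s := by
      intro s hs
      induction s with
      | zero => simp [decode]
      | succ s ih =>
        rw [decode, ih (Nat.le_of_succ_le hs)]
        rw [show π (x.append (Stream'.Seq.ofList ((List.ofFn y).take s))) = y ⟨s, hs⟩ from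
          h ⟨s, hs⟩]
        exact (y.take_ofFn_succ ⟨s, hs⟩).symm
    funext t
    rw [cot, hdec t t.2.le]
    exact h t

theorem NextTokenModel.cot_mem_iff {π π' : NextTokenModel Tok} {x : TokenString Tok}
    {D : Set (Response Tok T)}
    (h : ∀ y ∈ D, ∀ t : Fin T, π (y.prefixString x t) = π' (y.prefixString x t)) :
    π.cot T x ∈ D ↔ π'.cot T x ∈ D := by
  constructor
  · intro hD
    rwa [(π'.cot_eq_iff x _).2 fun t => ?_]
    rw [← h _ hD]
    exact (π.cot_eq_iff x _).1 rfl t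
  · intro hD
    rwa [(π.cot_eq_iff x _).2 fun t => ?_]
    rw [h _ hD]
    exact (π'.cot_eq_iff x _).1 rfl t

/-- Two samples of `n` prompts see at most `((2 n c T + 1) |Tok|²) ^ d` patterns of membership of
chains of thought in sets of at most `c` responses. -/
theorem exists_cover_cot [Fintype Tok] [Nonempty Tok] {X : Set (TokenString Tok)}
    {M : Set (NextTokenModel Tok)} {d : ℕ} (hd : natarajanDim M = d)
    (D : X → Set (Response Tok T)) {c : ℕ} (hD : ∀ x, (D x).ncard ≤ c) {n : ℕ}
    (v w : Fin n → X) :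
    ∃ G : Finset (NextTokenModel Tok),
      G.card ≤ ((2 * n * c * T + 1) * Fintype.card Tok ^ 2) ^ d ∧ ∀ π ∈ M, ∃ g ∈ G, ∀ j,
        (v j ∈ {x : X | π.cot T x ∉ D x} ↔ v j ∈ {x : X | g.cot T x ∉ D x}) ∧
          (w j ∈ {x : X | π.cot T x ∉ D x} ↔ w j ∈ {x : X | g.cot T x ∉ D x}) := by
  classical
  have hfin : ∀ x, (D x).Finite := fun x => Set.toFinite _
  -- `P` collects the proper prefixes of all members of `D` at all `2n` prompts; by
  -- `NextTokenModel.cot_mem_iff`, agreement on `P` forces equal patterns.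
  let P : Finset (TokenString Tok) := (Finset.univ : Finset (Fin n ⊕ Fin n)).biUnion fun j =>
    (hfin (Sum.elim v w j)).toFinset.biUnion fun y =>
      (Finset.univ : Finset (Fin T)).image fun t : Fin T => y.prefixString (Sum.elim v w j : X) t
  have hP : P.card ≤ 2 * n * c * T := by
    calc P.card ≤ (Finset.univ : Finset (Fin n ⊕ Fin n)).card * (c * T) := by
          refine Finset.card_biUnion_le_card_mul _ _ _ fun j _ => ?_
          refine (Finset.card_biUnion_le_card_mul _ _ T fun y _ => ?_).trans ?_
          · exact Finset.card_image_le.trans (by simp)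
          · refine Nat.mul_le_mul_right _ ?_
            rw [← Set.ncard_eq_toFinset_card]
            exact hD _
      _ = 2 * n * c * T := by
          rw [Finset.card_univ, Fintype.card_sum, Fintype.card_fin]
          ring
  obtain ⟨G, -, hGc, hG⟩ := exists_finset_cover_of_natarajanShatters P d M
    fun S _ h => h.card_le hd
  refine ⟨G, hGc.trans (Nat.pow_le_pow_left (Nat.mul_le_mul_right _ (by omega)) _), ?_⟩
  intro π hπ
  obtain ⟨g, hg, hgP⟩ := hG π hπ
  have key : ∀ j, π.cot T (Sum.elim v w j : X) ∈ D (Sum.elim v w j) ↔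
      NextTokenModel.cot g T (Sum.elim v w j : X) ∈ D (Sum.elim v w j) := by
    intro j
    refine NextTokenModel.cot_mem_iff fun y hy t => hgP _ ?_
    exact Finset.mem_biUnion.2 ⟨j, Finset.mem_univ _, Finset.mem_biUnion.2
      ⟨y, (hfin _).mem_toFinset.2 hy, Finset.mem_image_of_mem _ (Finset.mem_univ t)⟩⟩
  exact ⟨g, hg, fun j => ⟨not_congr (key (Sum.inl j)), not_congr (key (Sum.inr j))⟩⟩

theorem indicatorLoss_eq {X : Set (TokenString Tok)} {n : ℕ} (π : NextTokenModel Tok)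
    (xs : Fin n → X) (Ds : Fin n → Finset (Response Tok T)) (D : X → Set (Response Tok T))
    (h : ∀ i, (Ds i : Set (Response Tok T)) = D (xs i)) :
    indicatorLoss π xs Ds = hits {x : X | π.cot T x ∉ D x} xs / n := by
  classical
  have h' : ∀ i, π.cot T (xs i) ∈ Ds i ↔ π.cot T (xs i) ∈ D (xs i) := by
    intro i
    rw [← h i, Finset.mem_coe]
  simp only [indicatorLoss, h', hits]
  congr 1
  rw [Finset.card_filter]
  push_cast
  refine Finset.sum_congr rfl fun i _ => ?_
  by_cases hi : π.cot T (xs i) ∈ D (xs i) <;> simp [hi]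

end

/-! ### Reduction of the algorithm to risk minimization -/

section

variable {Tok : Type*} {X : Set (TokenString Tok)} {T : ℕ} [NeZero T]
  (πref : X → PMF (Response Tok T)) (V : X → Tok → Bool)

/-- `πstar` leaves the accepted set only where coverage fails or on the null set where its answer is
rejected. -/
theorem pr_cot_notMem_acceptedSet_le (ρ : PMF X) {πstar : NextTokenModel Tok} {C η : ℝ}
    (hacc : accuracy ρ V (fun x => πstar.outcome T x) = 1)
    (hcov : PartialSeqCoverage ρ πref πstar C η) :
    ρ.pr {x : X | πstar.cot T x ∉ acceptedSet πref V C x} ≤ η := by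
  have h1 := ρ.pr_add_compl {x | C⁻¹ ≤ (πref x (πstar.cot T x)).toReal}
  have h2 := ρ.pr_add_compl {x : X | V x (πstar.outcome T x) = true}
  have h3 : ρ.pr {x : X | V x (πstar.outcome T x) = true} = 1 := hacc
  have h4 := ρ.pr_union_le {x | C⁻¹ ≤ (πref x (πstar.cot T x)).toReal}ᶜ
    {x : X | V x (πstar.outcome T x) = true}ᶜ
  have h5 : 1 - η ≤ ρ.pr {x | C⁻¹ ≤ (πref x (πstar.cot T x)).toReal} := hcov
  have h6 : {x : X | πstar.cot T x ∉ acceptedSet πref V C x} ⊆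
      {x | C⁻¹ ≤ (πref x (πstar.cot T x)).toReal}ᶜ ∪
        {x : X | V x (πstar.outcome T x) = true}ᶜ := by
    intro x hx
    by_contra hcon
    simp only [Set.mem_union, Set.mem_compl_iff, not_or, not_not] at hcon
    exact hx ⟨hcon.1, hcon.2⟩
  linarith [ρ.pr_mono h6]

theorem one_sub_pr_cot_notMem_le_accuracy (ρ : PMF X) (π : NextTokenModel Tok) (C : ℝ) :
    1 - ρ.pr {x : X | π.cot T x ∉ acceptedSet πref V C x} ≤
      accuracy ρ V fun x => π.outcome T x := by
  have h1 := ρ.pr_add_compl {x : X | π.cot T x ∉ acceptedSet πref V C x}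
  have h2 : {x : X | π.cot T x ∉ acceptedSet πref V C x}ᶜ ⊆
      {x : X | V x (π.outcome T x) = true} := by
    intro x hx
    exact (not_not.1 hx).2
  have h3 := ρ.pr_mono h2
  simp only [accuracy]
  linarith

/-- The failure probability of `RLFineTune` is bounded by the probability of bad prompts and the
probability that rejection sampling misses an accepted response. -/
theorem one_sub_le_pr_rlFineTuneLaw [Finite Tok] (ρ : PMF X) {C δ b : ℝ} (hC : 0 < C)
    (hδ : 0 < δ) (hb : 0 ≤ b) {n : ℕ} (hn : 0 < n)
    (erm : (Fin n → X) → (Fin n → Finset (Response Tok T)) → NextTokenModel Tok)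
    (Q : Set (X → Tok)) (Bad : Set (Fin n → X)) (hBad : (ρ.iid n).pr Bad ≤ b)
    (hgood : ∀ xs ∉ Bad, ∀ Ds : Fin n → Finset (Response Tok T),
      (∀ i, (Ds i : Set (Response Tok T)) = acceptedSet πref V C (xs i)) →
        (fun x : X => (erm xs Ds).outcome T x) ∈ Q) :
    1 - (b + δ / 4) ≤ (rlFineTuneLaw ρ πref V erm C δ).pr {e | e.result ∈ Q} := by
  have h1 := (rlFineTuneLaw ρ πref V erm C δ).pr_add_compl {e | e.result ∈ Q}
  suffices h : (rlFineTuneLaw ρ πref V erm C δ).pr {e | e.result ∈ Q}ᶜ ≤ b + δ / 4 by linarith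
  refine PMF.pr_le_of_expect_le _ _ (by positivity) ?_
  have hrun : ∀ xs, ((rlFineTune erm C δ xs).run πref V).expect
      ({e | e.result ∈ Q}ᶜ.indicator 1) =
        ((rejectionSampleAll C (rolloutsPerPrompt n C δ) xs).resultLaw πref V).expect
          fun Ds => Qᶜ.indicator 1 fun x : X => (erm xs Ds).outcome T x := by
    intro xs
    have h2 : ((rlFineTune erm C δ xs).run πref V).expect ({e | e.result ∈ Q}ᶜ.indicator 1) =
        ((rlFineTune erm C δ xs).resultLaw πref V).expect (Qᶜ.indicator 1) := by
      rw [OracleProg.resultLaw, PMF.expect_map]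
      rfl
    rw [h2, rlFineTune, OracleProg.resultLaw_bind, PMF.expect_bind]
    simp only [OracleProg.resultLaw_pure, PMF.expect_pure]
  rw [rlFineTuneLaw, PMF.expect_bind]
  simp only [hrun]
  calc _ ≤ (ρ.iid n).expect fun xs => Bad.indicator 1 xs + ENNReal.ofReal (δ / 4) := by
        refine PMF.expect_mono _ fun xs => ?_
        refine le_trans ?_ (add_le_add_right
          (expect_rejectionSampleAll_rolloutsPerPrompt_ne πref V hC hδ hn xs) _)
        rw [← PMF.expect_const ((rejectionSampleAll C (rolloutsPerPrompt n C δ) xs).resultLaw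
          πref V) (Bad.indicator 1 xs), ← PMF.expect_add]
        refine PMF.expect_mono _ fun Ds => ?_
        refine Set.indicator_apply_le' (fun hQ => ?_) fun _ => bot_le
        by_cases hxs : xs ∈ Bad
        · refine le_add_right ?_
          rw [Set.indicator_of_mem hxs]
          rfl
        · refine le_add_left ?_
          rw [Set.indicator_of_mem]
          · rfl
          · by_contra hne
            refine hQ (hgood xs hxs Ds fun i => ?_)
            by_contra hi
            exact hne ⟨i, hi⟩
    _ ≤ _ := by
        rw [PMF.expect_add, PMF.expect_const, ENNReal.ofReal_add hb (by positivity),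
          ← PMF.ofReal_pr]
        gcongr

theorem calls_le_of_mem_support_rlFineTuneLaw (ρ : PMF X) {C δ : ℝ} (hC : 1 ≤ C) (hδ : 0 < δ)
    (hδ1 : δ < 1) {n : ℕ} (hn : 2 ≤ n)
    (erm : (Fin n → X) → (Fin n → Finset (Response Tok T)) → NextTokenModel Tok) :
    ∀ e ∈ (rlFineTuneLaw ρ πref V erm C δ).support,
      (e.rollouts : ℝ) ≤ 5 * (n * C * Real.log (n * C / δ)) ∧
        (e.verifierCalls : ℝ) ≤ 5 * (n * C * Real.log (n * C / δ)) := by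
  intro e he
  simp only [rlFineTuneLaw, PMF.support_bind, Set.mem_iUnion] at he
  obtain ⟨xs, -, he⟩ := he
  obtain ⟨h1, h2⟩ := rlFineTune_calls πref V erm C δ xs e he
  have h3 := rolloutsPerPrompt_le hn hC hδ hδ1
  have h4 : (n : ℝ) * rolloutsPerPrompt n C δ ≤ 5 * (n * C * Real.log (n * C / δ)) := by
    calc (n : ℝ) * rolloutsPerPrompt n C δ ≤ n * (5 * (C * Real.log (n * C / δ))) := by gcongr
      _ = _ := by ring
  rw [h1, h2]
  push_cast
  exact ⟨h4, h4⟩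

end

/-! ### Growth function and conclusion -/

theorem nontrivial_of_natarajanDim_pos {α β : Type*} {F : Set (α → β)}
    (h : 0 < natarajanDim F) : Nontrivial β := by
  simp only [natarajanDim, lt_iSup_iff] at h
  obtain ⟨S, ⟨f₀, f₁, hne, -⟩, hS⟩ := h
  have hS' : 0 < S.card := by exact_mod_cast hS
  obtain ⟨a, ha⟩ := Finset.card_pos.1 hS'
  exact ⟨f₀ a, f₁ a, hne a ha⟩

/-- The base is at most `4 n C T k²`, with logarithm at most `2 log 2 + log n + 2 log (T k C)`. Both
`log n` and `log (T k C)` are at least `log 2`, so the sum is bounded by 8 times their product. -/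
theorem log_growth_le {n T k d : ℕ} {C : ℝ} (hn : 2 ≤ n) (hT : 1 ≤ T) (hk : 2 ≤ k) (hC : 1 ≤ C) :
    Real.log ((((2 * n * ⌊C⌋₊ * T + 1) * k ^ 2) ^ d : ℕ) : ℝ) ≤
      8 * (d * Real.log (T * k * C) * Real.log n) := by
  have hn' : (2 : ℝ) ≤ n := by exact_mod_cast hn
  have hT' : (1 : ℝ) ≤ T := by exact_mod_cast hT
  have hk' : (2 : ℝ) ≤ k := by exact_mod_cast hk
  have hlog2 := Real.log_two_gt_d9
  have hlog2' := Real.log_two_lt_d9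
  have hy : Real.log 2 ≤ Real.log n := Real.log_le_log two_pos hn'
  have hlk : Real.log 2 ≤ Real.log k := Real.log_le_log two_pos hk'
  have hlT := Real.log_nonneg hT'
  have hlC := Real.log_nonneg hC
  have hx : Real.log (T * k * C) = Real.log T + Real.log k + Real.log C := by
    rw [Real.log_mul (by positivity) (by positivity), Real.log_mul (by positivity) (by positivity)]
  have hle : ((2 * n * ⌊C⌋₊ * T + 1) * k ^ 2 : ℝ) ≤ 4 * n * C * T * k ^ 2 := by
    have h1 : (⌊C⌋₊ : ℝ) ≤ C := Nat.floor_le (by linarith)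
    have h2 : 2 * n * (⌊C⌋₊ : ℝ) * T ≤ 2 * n * C * T := by gcongr
    have h3 : 1 ≤ n * C * T := by
      have : 1 ≤ n * C := by nlinarith
      nlinarith
    gcongr
    linarith
  have hlog : Real.log ((2 * n * ⌊C⌋₊ * T + 1) * k ^ 2 : ℝ) ≤
      2 * Real.log 2 + Real.log n + Real.log C + Real.log T + 2 * Real.log k := by
    refine (Real.log_le_log (by positivity) hle).trans (le_of_eq ?_)
    rw [Real.log_mul (by positivity) (by positivity), Real.log_mul (by positivity) (by positivity),
      Real.log_mul (by positivity) (by positivity), Real.log_mul (by positivity) (by positivity),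
      Real.log_pow, show (4 : ℝ) = 2 ^ 2 by norm_num, Real.log_pow]
    norm_num
  have hmain : 2 * Real.log 2 + Real.log n + 2 * Real.log (T * k * C) ≤
      8 * (Real.log (T * k * C) * Real.log n) := by
    have hx2 : Real.log 2 ≤ Real.log (T * k * C) := by linarith
    generalize Real.log (T * k * C) = x at *
    generalize Real.log n = y at *
    nlinarith [mul_nonneg (sub_nonneg.2 hx2) (sub_nonneg.2 hy)]
  push_cast
  rw [Real.log_pow]
  calc (d : ℝ) * Real.log ((2 * n * ⌊C⌋₊ * T + 1) * k ^ 2 : ℝ)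
      ≤ d * (8 * (Real.log (T * k * C) * Real.log n)) := by
        gcongr
        linarith
    _ = _ := by ring

theorem mainTheorem3 :
    ∃ C₁ C₂ C₃ : ℝ, 0 < C₁ ∧ 0 < C₂ ∧ 0 < C₃ ∧
      ∀ (Tok : Type*) [Fintype Tok] (X : Set (TokenString Tok)) (T : ℕ) [NeZero T]
        (ρ : PMF X) (V : X → Tok → Bool) (M : Set (NextTokenModel Tok)) (d : ℕ)
        (πstar : NextTokenModel Tok) (πref : X → PMF (Response Tok T))
        (Cseq η ε δ : ℝ) (n : ℕ)
        (erm : (Fin n → X) → (Fin n → Finset (Response Tok T)) → NextTokenModel Tok),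
        natarajanDim M = d →
        πstar ∈ M →
        accuracy ρ V (fun x => πstar.outcome T x) = 1 →
        1 ≤ Cseq →
        PartialSeqCoverage ρ πref πstar Cseq η →
        0 < ε → ε < 1 → 0 < δ → δ < 1 →
        IsERM M erm →
        2 ≤ n →
        C₁ * ((d * Real.log (T * Fintype.card Tok * Cseq) * Real.log n + Real.log (1 / δ)) / ε)
          ≤ n →
        1 - δ ≤ (rlFineTuneLaw ρ πref V erm Cseq δ).pr
            {e | 1 - C₂ * (ε + η) ≤ accuracy ρ V e.result} ∧
        ∀ e ∈ (rlFineTuneLaw ρ πref V erm Cseq δ).support,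
          (e.rollouts : ℝ) ≤ C₃ * (n * Cseq * Real.log (n * Cseq / δ)) ∧
          (e.verifierCalls : ℝ) ≤ C₃ * (n * Cseq * Real.log (n * Cseq / δ)) := by
  refine ⟨13, 20, 5, by norm_num, by norm_num, by norm_num, ?_⟩
  intro Tok _ X T _ ρ V M d πstar πref C η ε δ n erm hd hstar hacc hC hcov hε hε1 hδ hδ1 herm hn
    hsize
  refine ⟨?_, calls_le_of_mem_support_rlFineTuneLaw πref V ρ hC hδ hδ1 hn erm⟩
  have hC0 : 0 < C := by linarith
  have hn0 : 0 < n := by omega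
  have hnR : (2 : ℝ) ≤ n := by exact_mod_cast hn
  have hη := pr_cot_notMem_acceptedSet_le πref V ρ hacc hcov
  have hη0 : 0 ≤ η := (ρ.pr_nonneg _).trans hη
  -- For `d = 0` the dimension term vanishes, but the class is a single model, so `erm` returns
  -- `πstar`. For `d > 0` there are at least two tokens, which makes the logarithms positive.
  rcases Nat.eq_zero_or_pos d with rfl | hdpos
  · refine le_trans ?_ (one_sub_le_pr_rlFineTuneLaw πref V ρ hC0 hδ le_rfl hn0 erm
      {f | 1 - 20 * (ε + η) ≤ accuracy ρ V f} ∅ ?_ ?_)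
    · linarith
    · simp [PMF.pr]
    · intro xs _ Ds _
      rw [eq_of_natarajanDim_eq_zero (by simpa using hd) (herm xs Ds).1 hstar, Set.mem_ofPred_eq,
        hacc]
      nlinarith
  have : Nontrivial Tok := nontrivial_of_natarajanDim_pos (F := M) (by
    rw [hd]
    exact_mod_cast hdpos)
  have hk : 2 ≤ Fintype.card Tok := Fintype.one_lt_card
  set N := ((2 * n * ⌊C⌋₊ * T + 1) * Fintype.card Tok ^ 2) ^ d
  have hN0 : (0 : ℝ) < N := by
    have : 0 < N := by positivity
    exact_mod_cast this
  have hgrowth : Real.log N ≤ _ := log_growth_le (d := d) hn (NeZero.one_le (n := T)) hk hC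
  set Λ := d * Real.log (T * Fintype.card Tok * C) * Real.log n with hΛ
  have hlog2 := Real.log_two_gt_d9
  have hlog2' := Real.log_two_lt_d9
  -- `0.48 < (log 2)²`. This lower bound lets `Λ` absorb the additive constants below.
  have hΛ0 : 0.48 ≤ Λ := by
    have h1 : (1 : ℝ) ≤ d := by exact_mod_cast hdpos
    have h2 : Real.log 2 ≤ Real.log (T * Fintype.card Tok * C) := by
      refine Real.log_le_log two_pos ?_
      have h3 : (2 : ℝ) ≤ Fintype.card Tok := by exact_mod_cast hk
      have h4 : (1 : ℝ) ≤ T := by exact_mod_cast NeZero.one_le (n := T)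
      have h5 : (2 : ℝ) ≤ T * Fintype.card Tok := by nlinarith
      nlinarith
    have h6 : Real.log 2 ≤ Real.log n := Real.log_le_log two_pos hnR
    calc (0.48 : ℝ) ≤ 1 * Real.log 2 * Real.log 2 := by nlinarith
      _ ≤ Λ := by
        rw [hΛ]
        have h7 : 0 ≤ Real.log (T * Fintype.card Tok * C) := by linarith
        gcongr
  have hδlog : 0 < Real.log (1 / δ) := Real.log_pos (by rw [lt_div_iff₀ hδ]; linarith)
  have hnε : 13 * (Λ + Real.log (1 / δ)) ≤ n * ε := by
    rwa [← mul_div_assoc, div_le_iff₀ hε] at hsize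
  set α := ε + η with hα
  have hnα : n * ε ≤ n * α := by
    gcongr
    linarith
  set D : X → Set (Response Tok T) := acceptedSet πref V C with hD
  set A : NextTokenModel Tok → Set X := fun π => {x : X | π.cot T x ∉ D x} with hA
  have hcover : ∀ v w : Fin n → X, ∃ G : Finset (NextTokenModel Tok), G.card ≤ N ∧ ∀ i ∈ M,
      ∃ g ∈ G, ∀ j, (v j ∈ A i ↔ v j ∈ A g) ∧ (w j ∈ A i ↔ w j ∈ A g) := fun v w =>
    exists_cover_cot hd D (fun x => Nat.le_floor (ncard_acceptedSet_le πref V hC0 x)) v w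
  -- The exponent is `n * α` times `2 log 2 - 10 log (3/2)`, which is below `-1.9`; it beats `log N
  -- ≤ 8 * Λ` because `n * α ≥ 13 * (Λ + log (1 / δ))`.
  have hdev := ρ.pr_exists_hits_le M A n N (20 * α) (2 * (n * α)) hcover (by linarith)
  have hup := ρ.pr_lt_hits_le n (A πstar) (2 * (n * α))
  have hlogδ : Real.log (δ / 4) = -Real.log (1 / δ) - 2 * Real.log 2 := by
    rw [Real.log_div hδ.ne' (by norm_num), one_div, Real.log_inv,
      show (4 : ℝ) = 2 ^ 2 by norm_num, Real.log_pow]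
    norm_num
  have hup' : (ρ.iid n).pr {v | 2 * (n * α) < hits (A πstar) v} ≤ δ / 4 := by
    refine hup.trans ?_
    rw [← Real.le_log_iff_exp_le (by positivity), hlogδ]
    -- The `η` part of the exponent is nonpositive because `2 log 2 > 1`; the `ε` part supplies `log
    -- (δ / 4)`.
    have h1 : (n : ℝ) * ρ.pr (A πstar) ≤ n * η := by gcongr
    have h2 : (n : ℝ) * α = n * ε + n * η := by rw [hα]; ring
    have h3 : 0 ≤ (n : ℝ) * η := by positivity
    nlinarith
  have hdev' : (ρ.iid n).pr {v | ∃ π ∈ M, 20 * α ≤ ρ.pr (A π) ∧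
      (hits (A π) v : ℝ) ≤ 2 * (n * α)} ≤ δ / 4 := by
    refine hdev.trans ?_
    rw [← Real.log_le_log_iff (by positivity) (by positivity), hlogδ,
      Real.log_mul (by positivity) (by positivity), Real.log_mul (by norm_num) hN0.ne',
      Real.log_exp]
    have h32 : 1 / 3 ≤ Real.log (3 / 2) := by
      have := Real.one_sub_inv_le_log_of_pos (x := 3 / 2) (by norm_num)
      norm_num at this ⊢
      exact this
    nlinarith
  have hfinal := one_sub_le_pr_rlFineTuneLaw πref V ρ hC0 hδ (b := δ / 4 + δ / 4) (by positivity)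
    hn0 erm {f | 1 - 20 * α ≤ accuracy ρ V f} _
    (((ρ.iid n).pr_union_le _ _).trans (add_le_add hup' hdev')) ?_
  · refine le_trans ?_ hfinal
    linarith
  · intro xs hxs Ds hDs
    simp only [Set.mem_union, Set.mem_ofPred_eq, not_or, not_lt, not_exists, not_and, not_le] at hxs
    obtain ⟨hmem, hmin⟩ := herm xs Ds
    have hloss := hmin πstar hstar
    rw [indicatorLoss_eq _ xs Ds D hDs, indicatorLoss_eq _ xs Ds D hDs,
      div_le_div_iff_of_pos_right (by positivity)] at hloss
    -- The minimizer has at most as many empirical errors as `πstar`, hence at most `2nα`, which the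
    -- deviation event forbids for a risk of `20α` or more.
    have h1 : ρ.pr (A (erm xs Ds)) < 20 * α := by
      by_contra hcon
      exact absurd (hxs.2 _ hmem (not_lt.1 hcon)) (not_lt.2 (hloss.trans hxs.1))
    have h2 := one_sub_pr_cot_notMem_le_accuracy πref V ρ (erm xs Ds) C
    rw [Set.mem_ofPred_eq]
    linarith
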